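/- Let $q$ be a prime power and $n\ge 0$. Let $\mathrm{PGL}(n,\mathbb F_q)$ be $\mathrm{GL}(n,\mathbb F_q)$ modulo its center. Let $\mathrm{U}(n,\mathbb F_q)$ be the group of all $g=(a_{ij})\in \mathrm{GL}(n,\mathbb F_{q^2})$ with $g={}^{\top}(a_{ij}^q)^{-1}$, and let $\mathrm{PGU}(n,\mathbb F_q)$ be $\mathrm{U}(n,\mathbb F_q)$ modulo its center. (For $n=0$ all these groups are trivial.) A conjugacy class of a group is real if it contains the inverse of each of its elements. For a square matrix $A$ of size $n$ over a field $k$, write the $k[t]$-module $k^n$ on which $t$ acts as $A$ as $\bigoplus_j k[t]/(p_j^{e_j})$ with $p_j$ monic irreducible and $e_j\ge 1$, and put $f_i=\prod_{j:\,e_j=i}p_j$ for $i\ge 1$. We say that $A$ is of type $\nu=(1^{m_1}2^{m_2}\cdots)$, a partition of $n$ in which the part $i$ has multiplicity $m_i$, if $\deg f_i=m_i$ for all $i\ge 1$. A conjugacy class of $\mathrm{PGL}(n,\mathbb F_q)$ (respectively $\mathrm{PGU}(n,\mathbb F_q)$) is of type $\nu$ if it is the image of the conjugacy class of an element of $\mathrm{GL}(n,\mathbb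 F_q)$ (with $k=\mathbb F_q$) (respectively of $\mathrm{U}(n,\mathbb F_q)$, with $k=\mathbb F_{q^2}$) of type $\nu$. Let $pgl_\nu$ and $pgu_\nu$ be the numbers of real conjugacy classes of type $\nu$ of $\mathrm{PGL}(n,\mathbb F_q)$ and $\mathrm{PGU}(n,\mathbb F_q)$. For $d\ge 0$ let $r_{q,d}$ be the number of monic polynomials $f\in\mathbb F_q[t]$ of degree $d$ with $f(0)\neq 0$ that are self-reciprocal, that is, $f(t)=f(0)^{-1}t^{d}f(t^{-1})$. Then for every partition $\nu=(1^{m_1}2^{m_2}\cdots)$ of $n$, $$pgu_\nu=\begin{cases}\displaystyle\prod_{i:\,m_i>0} r_{q,m_i} & \text{if } q \text{ is even, or if } q \text{ is odd and } m_i \text{ is even for all } i,\\[2ex] \displaystyle\frac12\prod_{i:\,m_i>0} r_{q,m_i} & \text{if } q \text{ is odd and } m_i \text{ is odd for some } i.\end{cases}$$ Moreover $pgl_\nu=pgu_\nu$ for every partition $\nu$ of $n$. In particular, the number of real conjugacy classes of $\mathrm{PGL}(n,\mathbb F_q)$ is equal to the number of real conjugacy classes of $\mathrm{PGU}(n,\mathbb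 F_q)$. -/

import Mathlib

open scoped Polynomial DirectSum

namespace RealClasses

noncomputable section

/-- A conjugacy class of a group is real if it contains the inverse of each of its elements. -/
def IsReal {G : Type*} [Group G] (c : ConjClasses G) : Prop :=
  ∀ g ∈ c.carrier, g⁻¹ ∈ c.carrier

/-! ### Unitary groups -/

theorem transpose_frobenius_mul (F : Type*) {K : Type*} [Field F] [Fintype F] [Field K]
    [Algebra F K] {n : ℕ} (A B : Matrix (Fin n) (Fin n) K) :
    ((A * B).map (fun a => a ^ Fintype.card F)).transpose =
      (B.map (fun a => a ^ Fintype.card F)).transpose *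
        (A.map (fun a => a ^ Fintype.card F)).transpose := by
  have h : ((A * B).map (FiniteField.frobeniusAlgHom F K)).transpose =
      (B.map (FiniteField.frobeniusAlgHom F K)).transpose *
        (A.map (FiniteField.frobeniusAlgHom F K)).transpose := by
    rw [Matrix.map_mul, Matrix.transpose_mul]
  exact h

theorem transpose_frobenius_one (F K : Type*) [Field F] [Fintype F] [Field K] [Algebra F K]
    (n : ℕ) :
    ((1 : Matrix (Fin n) (Fin n) K).map (fun a => a ^ Fintype.card F)).transpose = 1 := by
  have h : ((1 : Matrix (Fin n) (Fin n) K).map (FiniteField.frobeniusAlgHom F K)).transpose = 1 := by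
    rw [Matrix.map_one _ (map_zero _) (map_one _), Matrix.transpose_one]
  exact h

/-- For an extension `K` of the finite field `F` with `q` elements, the endomorphism of `GL(n, K)`
sending a matrix `(a i j)` to the inverse of the transpose of `((a i j) ^ q)`. -/
def twistedFrobenius (F K : Type*) [Field F] [Fintype F] [Field K] [Algebra F K] (n : ℕ) :
    GL (Fin n) K →* GL (Fin n) K where
  toFun g := (Units.mk
    (g.val.map (fun a => a ^ Fintype.card F)).transpose
    ((g⁻¹ : GL (Fin n) K).val.map (fun a => a ^ Fintype.card F)).transpose
    (by rw [← transpose_frobenius_mul, Units.inv_mul, transpose_frobenius_one])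
    (by rw [← transpose_frobenius_mul, Units.mul_inv, transpose_frobenius_one]))⁻¹
  map_one' := by
    rw [inv_eq_one]
    exact Units.ext (transpose_frobenius_one F K n)
  map_mul' g h := by
    rw [← mul_inv_rev, inv_inj]
    exact Units.ext (transpose_frobenius_mul F g.val h.val)

/-- The unitary group `U(n, F)`, where `K` is the quadratic extension of the finite field `F`:
the group of fixed points in `GL(n, K)` of the twisted Frobenius map. -/
def U (F K : Type*) [Field F] [Fintype F] [Field K] [Algebra F K] (n : ℕ) :
    Subgroup (GL (Fin n) K) :=
  (twistedFrobenius F K n).eqLocus (MonoidHom.id _)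

/-- The projective unitary group: the unitary group modulo its center. -/
abbrev PGU (F K : Type*) [Field F] [Fintype F] [Field K] [Algebra F K] (n : ℕ) : Type _ :=
  U F K n ⧸ Subgroup.center (U F K n)

/-- The projective linear group: the general linear group modulo its center. -/
abbrev PGL (F : Type*) [Field F] (n : ℕ) : Type _ := Matrix.ProjGenLinGroup (Fin n) F

/-! ### Types of conjugacy classes -/

/-- `(f 1, f 2, …)` is the sequence of monic polynomials attached to the similarity class of `A`:
if the `k[t]`-module defined by `A` is the direct sum of the modules `k[t] / (p j ^ e j)`, with
`p j` monic irreducible and `e j > 0`, then `f i` is the product of the `p j` with `e j = i`.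
The characteristic polynomial of `A` is then the product of the `f i ^ i`. -/
def IsClassSequence {k : Type*} [Field k] {n : ℕ} (A : Matrix (Fin n) (Fin n) k)
    (f : ℕ → k[X]) : Prop :=
  ∃ (s : ℕ) (p : Fin s → k[X]) (e : Fin s → ℕ),
    (∀ j, (p j).Monic ∧ Irreducible (p j) ∧ 0 < e j) ∧
    Nonempty (Module.AEval' (Matrix.toLin' A) ≃ₗ[k[X]] ⨁ j, k[X] ⧸ Ideal.span {p j ^ e j}) ∧
    ∀ i, f i = ∏ j with e j = i, p j

/-- The similarity class of `A` has type `ν = (1 ^ m₁ 2 ^ m₂ …)` if the polynomials in the sequence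
attached to `A` satisfy `deg (f i) = mᵢ` for all `i ≥ 1`. -/
def HasType {k : Type*} [Field k] {n : ℕ} (A : Matrix (Fin n) (Fin n) k)
    (ν : n.Partition) : Prop :=
  ∃ f : ℕ → k[X], IsClassSequence A f ∧ ∀ i, 1 ≤ i → (f i).natDegree = ν.parts.count i

/-- A class of `PGL(n, F)` is of type `ν` if it comes from a class of `GL(n, F)` of type `ν`. -/
def PGLHasType {F : Type*} [Field F] {n : ℕ} (ν : n.Partition) (c : ConjClasses (PGL F n)) : Prop :=
  ∃ g : GL (Fin n) F, ConjClasses.mk (Matrix.ProjGenLinGroup.mk g) = c ∧ HasType g.val ν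

/-- A class of `PGU(n, F)` is of type `ν` if it comes from a class of `U(n, F)` of type `ν`. -/
def PGUHasType {F K : Type*} [Field F] [Fintype F] [Field K] [Algebra F K] {n : ℕ}
    (ν : n.Partition) (c : ConjClasses (PGU F K n)) : Prop :=
  ∃ g : U F K n, ConjClasses.mk (QuotientGroup.mk g : PGU F K n) = c ∧ HasType g.val.val ν

/-- The number of real classes of `PGL(n, F)` of type `ν`. -/
def pgl (F : Type*) [Field F] {n : ℕ} (ν : n.Partition) : ℕ :=
  Nat.card {c : ConjClasses (PGL F n) // IsReal c ∧ PGLHasType ν c}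

/-- The number of real classes of `PGU(n, F)` of type `ν`. -/
def pgu (F K : Type*) [Field F] [Fintype F] [Field K] [Algebra F K] {n : ℕ}
    (ν : n.Partition) : ℕ :=
  Nat.card {c : ConjClasses (PGU F K n) // IsReal c ∧ PGUHasType ν c}

/-! ### Self-reciprocal polynomials -/

/-- The reciprocal polynomial `f(0)⁻¹ t ^ d f(t⁻¹)` of a polynomial `f` of degree `d`. -/
def reciprocal {F : Type*} [Field F] (f : F[X]) : F[X] :=
  Polynomial.C (f.coeff 0)⁻¹ * f.reverse

/-- The number of self-reciprocal monic polynomials over `F` of degree `d` with nonzero constant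
term. -/
def r (F : Type*) [Field F] (d : ℕ) : ℕ :=
  Nat.card {f : F[X] // f.Monic ∧ f.coeff 0 ≠ 0 ∧ f.natDegree = d ∧ reciprocal f = f}

end

end RealClasses

/-!
The similarity class of an invertible matrix `g` is determined by its class sequence
`f = (f 1, f 2, …)`: the ranks of `a(g)`, for `a` running over the powers of monic irreducible
polynomials, determine the elementary divisors, and unique factorization recovers these from `f`
(`IsClassSequence.unique`, `IsClassSequence.similar`). All sequences of monic polynomials with
nonzero constant terms and the right degrees occur (`exists_classSeq_eq`). The same ranks show what
happens to `f` under operations on `g` (`IsClassSequence.transfer`): inversion replaces the `f i` by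
their reciprocals, a scalar `c` multiplies their roots by `c` (written `c • f`), and transposition
with a field automorphism applied to the entries applies the automorphism to the coefficients.
Write `f.rev` for the sequence of reciprocals and `f ↦ f.map star` for the action of `a ↦ a ^ q` on
coefficients over the field with `q ^ 2` elements.

For the unitary group two facts are needed: unitary matrices which are similar are conjugate in the
unitary group (`exists_unitary_similar`), and the sequences with `f.rev = f.map star` are exactly
those of unitary matrices (`exists_unitary_classSeq_eq`). Both reduce to statements on Hermitian
forms, which are proved inside commutative algebras generated by one matrix: in a finite commutative
ring with involution containing a unit `l - star l`, Hilbert 90 holds (`exists_isUnit_eq_star_mul`),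
and by comparing orders every self-adjoint unit is of the form `star y * y`
(`exists_star_mul_self_eq`).

Both projective groups are therefore quotients, by a group `T` of scalars, of a group whose classes
are classified by sequences on which `T` acts. A class of the quotient is a `T`-orbit of sequences
`f`, and it is real if and only if `f.rev = t • f` for some `t` in `T`. By Burnside's lemma
(`card_orbits_mul_card`) the number of real classes of type `ν` is the average over `t` of the
number of sequences of type `ν` with `f.rev = t • f`, where `T` consists of all units of
the field in the linear case (`pgl_mul_card`), and of those of norm one in the unitary case
(`pgu_mul_card`).

To compare the two, average over the `a` in `Kˣ` instead, with `t = a / star a` and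
`c = (a * star a)⁻¹`; both maps are surjective homomorphisms. Multiplication by `a` carries the
unitary sequences with `f.rev = t • f` to the sequences over `F` with `f.rev = c • f`
(`card_unitaryOfType_eq`), so that the two averages agree (`pgl_eq_pgu`).

The average in the linear case is computed directly. The number of `f` with `f.rev = c • f` depends
on `c` only up to squares. For `c = 1` it is the product of the numbers of self-reciprocal
polynomials. If all degrees are even it does not depend on `c` at all (`numSeq_eq_of_even`), and if
some degree is odd it vanishes unless `c` is a square (`numSeq_eq_zero`), which for odd `q` happens
for half of the `c`.
-/

namespace RealClasses
open Polynomial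

/-! ### Ranks of polynomials in an operator -/
section ElementaryDivisors
variable {k : Type*} [Field k]

/-- The dimension over `k` of the submodule `a M` of a `k[X]`-module `M`. -/
noncomputable def smulRank (M : Type*) [AddCommGroup M] [Module k M] [Module k[X] M]
    [IsScalarTower k k[X] M] (a : k[X]) : ℕ :=
  Module.finrank k (LinearMap.range (Algebra.lsmul k k M a))

theorem smulRank_congr {M N : Type*} [AddCommGroup M] [Module k M] [Module k[X] M]
    [IsScalarTower k k[X] M] [AddCommGroup N] [Module k N] [Module k[X] N]
    [IsScalarTower k k[X] N] (φ : M ≃ₗ[k[X]] N) (a : k[X]) :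
    smulRank M a = smulRank N a := by
  have h : (LinearMap.range (Algebra.lsmul k k M a)).map
      ((φ.restrictScalars k : M ≃ₗ[k] N) : M →ₗ[k] N) =
      LinearMap.range (Algebra.lsmul k k N a) := by
    rw [← LinearMap.range_comp]
    have : ((φ.restrictScalars k : M ≃ₗ[k] N) : M →ₗ[k] N) ∘ₗ Algebra.lsmul k k M a =
        (Algebra.lsmul k k N a : N →ₗ[k] N) ∘ₗ ((φ.restrictScalars k : M ≃ₗ[k] N) : M →ₗ[k] N) := by
      ext x; simp
    rw [this, LinearMap.range_comp, LinearEquiv.range, Submodule.map_top]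
  rw [smulRank, smulRank, ← h, LinearEquiv.finrank_map_eq]

theorem smulRank_pi {ι : Type*} [Fintype ι] (M : ι → Type*) [∀ i, AddCommGroup (M i)]
    [∀ i, Module k (M i)] [∀ i, Module k[X] (M i)] [∀ i, IsScalarTower k k[X] (M i)]
    [∀ i, Module.Finite k (M i)] (a : k[X]) :
    smulRank (∀ i, M i) a = ∑ i, smulRank (M i) a := by
  let g : (∀ i, LinearMap.range (Algebra.lsmul k k (M i) a)) →ₗ[k] (∀ i, M i) :=
    LinearMap.pi fun i => (Submodule.subtype _) ∘ₗ LinearMap.proj i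
  have hg : Function.Injective g := fun x y h => by
    ext i; exact congrFun h i
  have hr : LinearMap.range g = LinearMap.range (Algebra.lsmul k k (∀ i, M i) a) := by
    ext x
    constructor
    · rintro ⟨y, rfl⟩
      choose z hz using fun i => (y i).2
      exact ⟨z, by ext i; exact hz i⟩
    · rintro ⟨z, rfl⟩
      exact ⟨fun i => ⟨a • z i, z i, rfl⟩, rfl⟩
  rw [smulRank, ← hr, LinearMap.finrank_range_of_inj hg, Module.finrank_pi_fintype]
  rfl

/-- If `a x ∈ (b)` exactly when `x ∈ (c)`, then multiplication by `a` on `k[X] / (b)` has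
rank `deg c`. -/
theorem smulRank_quotient {a b c : k[X]} (h : ∀ x, b ∣ a * x ↔ c ∣ x) :
    smulRank (k[X] ⧸ Ideal.span {b}) a = c.natDegree := by
  obtain ⟨f, hf⟩ : ∃ f : k[X] →ₗ[k] (k[X] ⧸ Ideal.span {b}),
      ∀ x, f x = Ideal.Quotient.mk (Ideal.span {b}) (a * x) :=
    ⟨(Ideal.Quotient.mkₐ k (Ideal.span {b})).toLinearMap ∘ₗ LinearMap.mulLeft k a, fun _ => rfl⟩
  have hr : LinearMap.range f = LinearMap.range (Algebra.lsmul k k (k[X] ⧸ Ideal.span {b}) a) := by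
    ext y
    constructor
    · rintro ⟨x, rfl⟩
      exact ⟨Ideal.Quotient.mk _ x, by rw [hf]; rfl⟩
    · rintro ⟨z, rfl⟩
      obtain ⟨x, rfl⟩ := Ideal.Quotient.mk_surjective z
      exact ⟨x, by rw [hf]; rfl⟩
  have hk : LinearMap.ker f = (Ideal.span {c}).restrictScalars k := by
    ext x
    rw [LinearMap.mem_ker, hf, Ideal.Quotient.eq_zero_iff_mem, Ideal.mem_span_singleton, h,
      Submodule.restrictScalars_mem, Ideal.mem_span_singleton]
  rw [smulRank, ← hr, ← LinearEquiv.finrank_eq f.quotKerEquivRange, hk,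
    ← finrank_quotient_span_eq_natDegree (f := c)]
  exact (Submodule.Quotient.restrictScalarsEquiv k (Ideal.span {c})).finrank_eq

/-- The rank of multiplication by `π ^ j` on `k[X] / (p ^ e)` for `x = (p, e)`. -/
noncomputable def primeRank (π : k[X]) (j : ℕ) (x : k[X] × ℕ) : ℕ :=
  open Classical in (if x.1 = π then x.2 - j else x.2) * x.1.natDegree

theorem smulRank_primePower {π : k[X]} (hπ : π.Monic) (hπ' : Irreducible π) {x : k[X] × ℕ}
    (hx : x.1.Monic) (hx' : Irreducible x.1) (j : ℕ) :
    smulRank (k[X] ⧸ Ideal.span {x.1 ^ x.2}) (π ^ j) = primeRank π j x := by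
  obtain ⟨p, e⟩ := x
  dsimp only at hx hx' ⊢
  unfold primeRank
  split_ifs with h
  · dsimp only at h
    subst h
    rw [smulRank_quotient (c := p ^ (e - j)), natDegree_pow]
    intro y
    rcases le_total e j with he | he
    · simp only [Nat.sub_eq_zero_of_le he, pow_zero, one_dvd, iff_true]
      exact (pow_dvd_pow p he).mul_right y
    · conv_lhs => rw [← Nat.add_sub_of_le he, pow_add]
      exact mul_dvd_mul_iff_left (pow_ne_zero _ hx.ne_zero)
  · rw [smulRank_quotient (c := p ^ e), natDegree_pow]
    intro y
    have hc : IsCoprime p π := by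
      rw [hx'.coprime_iff_not_dvd]
      intro hd
      exact h (eq_of_monic_of_associated hx hπ ((hx'.dvd_irreducible_iff_associated hπ').1 hd))
    exact ⟨fun hd => hc.pow.dvd_of_dvd_mul_left hd, fun hd => hd.mul_left _⟩

theorem smulRank_aeval {n : ℕ} (A : Matrix (Fin n) (Fin n) k) (a : k[X]) :
    smulRank (Module.AEval' (Matrix.toLin' A)) a = (aeval A a).rank := by
  have h : (aeval (Matrix.toLin' A) a) = Matrix.toLin' (aeval A a) := by
    exact aeval_algHom_apply (Matrix.toLinAlgEquiv' : _ ≃ₐ[k] _) A a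
  rw [Matrix.rank, ← Matrix.toLin'_apply', ← h]
  rfl

/-! ### Elementary divisors -/

/-- The multiset `m` consists of pairs `(p, e)` with `p` monic irreducible and `e > 0`. -/
def IsPrimePowers (m : Multiset (k[X] × ℕ)) : Prop :=
  ∀ x ∈ m, x.1.Monic ∧ Irreducible x.1 ∧ 0 < x.2

/-- The multiset `m` of pairs `(p, e)`, with `p` monic irreducible and `e > 0`, is the multiset of
elementary divisors of `A`: the `k[X]`-module defined by `A` is isomorphic to the product of the
modules `k[X] / (p ^ e)`. -/
def HasElemDiv {n : ℕ} (A : Matrix (Fin n) (Fin n) k) (m : Multiset (k[X] × ℕ)) : Prop :=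
  IsPrimePowers m ∧ ∃ (s : ℕ) (x : Fin s → k[X] × ℕ), Multiset.map x Finset.univ.val = m ∧
    Nonempty (Module.AEval' (Matrix.toLin' A) ≃ₗ[k[X]]
      ∀ j, k[X] ⧸ Ideal.span {(x j).1 ^ (x j).2})

theorem HasElemDiv.rank_eq {n : ℕ} {A : Matrix (Fin n) (Fin n) k} {m : Multiset (k[X] × ℕ)}
    (h : HasElemDiv A m) {π : k[X]} (hπ : π.Monic) (hπ' : Irreducible π) (j : ℕ) :
    (aeval A (π ^ j)).rank = (m.map (primeRank π j)).sum := by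
  obtain ⟨hm, s, x, rfl, ⟨φ⟩⟩ := h
  have hx : ∀ j, (x j).1.Monic ∧ Irreducible (x j).1 ∧ 0 < (x j).2 := fun j =>
    hm _ (Multiset.mem_map_of_mem _ (Finset.mem_univ_val j))
  have : ∀ j, Module.Finite k (k[X] ⧸ Ideal.span {(x j).1 ^ (x j).2}) := fun j =>
    ((hx j).1.pow _).finite_quotient
  rw [← smulRank_aeval, smulRank_congr φ, smulRank_pi, Multiset.map_map]
  exact Finset.sum_congr rfl fun i _ => smulRank_primePower hπ hπ' (hx i).1 (hx i).2.1 j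

open Classical in
theorem primeRank_eq_add (π : k[X]) (j : ℕ) (x : k[X] × ℕ) :
    primeRank π j x =
      primeRank π (j + 1) x + if x.1 = π ∧ j < x.2 then π.natDegree else 0 := by
  unfold primeRank
  by_cases h : x.1 = π
  · subst h
    by_cases hj : j < x.2
    · rw [if_pos rfl, if_pos rfl, if_pos ⟨rfl, hj⟩, show x.2 - j = (x.2 - (j + 1)) + 1 by omega,
        add_mul, one_mul]
    · rw [if_pos rfl, if_pos rfl, if_neg (fun h => hj h.2), show x.2 - j = x.2 - (j + 1) by omega,
        add_zero]
  · simp [h]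

open Classical in
theorem sum_primeRank_eq_add (m : Multiset (k[X] × ℕ)) (π : k[X]) (j : ℕ) :
    (m.map (primeRank π j)).sum = (m.map (primeRank π (j + 1))).sum +
      m.countP (fun x => x.1 = π ∧ j < x.2) * π.natDegree := by
  induction m using Multiset.induction_on with
  | empty => simp
  | cons x m ih =>
    rw [Multiset.map_cons, Multiset.map_cons, Multiset.sum_cons, Multiset.sum_cons,
      Multiset.countP_cons, ih, primeRank_eq_add]
    split_ifs <;> ring

open Classical in
theorem countP_eq_count_add (m : Multiset (k[X] × ℕ)) (π : k[X]) (j : ℕ) :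
    m.countP (fun x => x.1 = π ∧ j < x.2) =
      m.countP (fun x => x.1 = π ∧ j + 1 < x.2) + m.count (π, j + 1) := by
  induction m using Multiset.induction_on with
  | empty => simp
  | cons x m ih =>
    rw [Multiset.countP_cons, Multiset.countP_cons, Multiset.count_cons, ih]
    obtain ⟨p, e⟩ := x
    by_cases h : p = π
    · subst h
      rcases lt_trichotomy e (j + 1) with he | he | he
      · rw [if_neg (by simp; omega), if_neg (by simp; omega), if_neg (by simp; omega)]
        simp only [add_zero]
      · rw [if_pos (by simp; omega), if_neg (by simp; omega), if_pos (by simp; omega)]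
        ring
      · rw [if_pos (by simp; omega), if_pos (by simp; omega), if_neg (by simp; omega)]
        ring
    · simp only [h, false_and, if_false, Prod.mk.injEq, Ne.symm h]
      ring

/-- The ranks of the powers of all primes determine the elementary divisors. -/
theorem IsPrimePowers.eq_of_sum_primeRank {m m' : Multiset (k[X] × ℕ)} (hm : IsPrimePowers m)
    (hm' : IsPrimePowers m') (h : ∀ π : k[X], π.Monic → Irreducible π → ∀ j,
      (m.map (primeRank π j)).sum = (m'.map (primeRank π j)).sum) : m = m' := by
  classical
  ext ⟨π, i⟩
  by_cases hx : π.Monic ∧ Irreducible π ∧ 0 < i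
  · obtain ⟨h1, h2, h3⟩ := hx
    have key : ∀ j, m.countP (fun x => x.1 = π ∧ j < x.2) =
        m'.countP (fun x => x.1 = π ∧ j < x.2) := fun j => by
      have e1 := sum_primeRank_eq_add m π j
      have e2 := sum_primeRank_eq_add m' π j
      rw [h π h1 h2, h π h1 h2, e2] at e1
      exact (Nat.eq_of_mul_eq_mul_right h2.natDegree_pos (Nat.add_left_cancel e1)).symm
    obtain ⟨j, rfl⟩ := Nat.exists_eq_add_of_le' h3
    have e1 := countP_eq_count_add m π j
    have e2 := countP_eq_count_add m' π j
    rw [key, key, e2] at e1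
    exact (Nat.add_left_cancel e1).symm
  · rw [Multiset.count_eq_zero_of_notMem (fun hh => hx (hm _ hh)),
      Multiset.count_eq_zero_of_notMem (fun hh => hx (hm' _ hh))]

theorem exists_equiv_of_map_univ_eq {α : Type*} {s s' : ℕ} {x : Fin s → α} {y : Fin s' → α}
    (h : Multiset.map x Finset.univ.val = Multiset.map y Finset.univ.val) :
    ∃ σ : Fin s ≃ Fin s', ∀ i, y (σ i) = x i := by
  classical
  have hf : ∀ c, Nonempty ({i // x i = c} ≃ {i // y i = c}) := fun c => by
    rw [← Fintype.card_eq, Fintype.card_subtype, Fintype.card_subtype]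
    have := congrArg (Multiset.count c) h
    rw [Multiset.count_map, Multiset.count_map] at this
    simpa [Finset.card, eq_comm] using this
  exact ⟨Equiv.ofFiberEquiv fun c => (hf c).some, fun i => Equiv.ofFiberEquiv_map _ i⟩

theorem exists_fin_map_univ_eq {α : Type*} (m : Multiset α) :
    ∃ (s : ℕ) (x : Fin s → α), Multiset.map x Finset.univ.val = m := by
  induction m using Quotient.inductionOn with
  | h l =>
    exact ⟨l.length, l.get, by rw [Fin.univ_val_map, List.ofFn_get]; rfl⟩

theorem HasElemDiv.unique {n : ℕ} {A : Matrix (Fin n) (Fin n) k} {m m' : Multiset (k[X] × ℕ)}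
    (h : HasElemDiv A m) (h' : HasElemDiv A m') : m = m' :=
  h.1.eq_of_sum_primeRank h'.1 fun π h1 h2 j => by rw [← h.rank_eq h1 h2, h'.rank_eq h1 h2]

/-- Reindexing a product of cyclic modules. -/
noncomputable def cyclicCongr {ι κ : Type*} {x : ι → k[X] × ℕ} {y : κ → k[X] × ℕ} (σ : ι ≃ κ)
    (h : ∀ i, y (σ i) = x i) :
    (∀ i, k[X] ⧸ Ideal.span {(x i).1 ^ (x i).2}) ≃ₗ[k[X]]
      ∀ i, k[X] ⧸ Ideal.span {(y i).1 ^ (y i).2} :=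
  (LinearEquiv.piCongrRight fun i => Submodule.quotEquivOfEq _ _ (by rw [h i])).trans
    (LinearEquiv.piCongrLeft k[X] (fun i => k[X] ⧸ Ideal.span {(y i).1 ^ (y i).2}) σ)

/-- Matrices with the same elementary divisors are similar. -/
theorem HasElemDiv.similar {n : ℕ} {A B : Matrix (Fin n) (Fin n) k} {m : Multiset (k[X] × ℕ)}
    (hA : HasElemDiv A m) (hB : HasElemDiv B m) : ∃ P : GL (Fin n) k, P.val * A = B * P.val := by
  obtain ⟨-, s, x, hx, ⟨φ⟩⟩ := hA
  obtain ⟨-, s', y, hy, ⟨ψ⟩⟩ := hB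
  obtain ⟨σ, hσ⟩ := exists_equiv_of_map_univ_eq (hx.trans hy.symm)
  let θ := (φ.trans (cyclicCongr σ hσ)).trans ψ.symm
  let e : (Fin n → k) ≃ₗ[k] (Fin n → k) := (Module.AEval'.of (Matrix.toLin' A)).trans
    ((θ.restrictScalars k).trans (Module.AEval'.of (Matrix.toLin' B)).symm)
  have he : ∀ v, e (Matrix.toLin' A v) = Matrix.toLin' B (e v) := fun v => by
    have h1 : θ (X • Module.AEval'.of (Matrix.toLin' A) v) =
      X • θ (Module.AEval'.of (Matrix.toLin' A) v) := map_smul _ _ _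
    rw [Module.AEval'.X_smul_of] at h1
    have h2 := congrArg (Module.AEval'.of (Matrix.toLin' B)).symm h1
    rw [Module.AEval'.of_symm_X_smul] at h2
    exact h2
  refine ⟨⟨LinearMap.toMatrix' e.toLinearMap, LinearMap.toMatrix' e.symm.toLinearMap, ?_, ?_⟩, ?_⟩
  · rw [← LinearMap.toMatrix'_comp, LinearEquiv.comp_symm, LinearMap.toMatrix'_id]
  · rw [← LinearMap.toMatrix'_comp, LinearEquiv.symm_comp, LinearMap.toMatrix'_id]
  · apply Matrix.toLin'.injective
    ext1 v
    simp only [Matrix.toLin'_mul, Matrix.toLin'_toMatrix']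
    ext1
    exact he _

/-- Every multiset of prime powers of total degree `n` comes from a matrix of size `n`. -/
theorem IsPrimePowers.exists_hasElemDiv {n : ℕ} {m : Multiset (k[X] × ℕ)} (hm : IsPrimePowers m)
    (hn : (m.map fun x => x.2 * x.1.natDegree).sum = n) :
    ∃ A : Matrix (Fin n) (Fin n) k, HasElemDiv A m := by
  obtain ⟨s, x, rfl⟩ := exists_fin_map_univ_eq m
  have hx : ∀ j, (x j).1.Monic ∧ Irreducible (x j).1 ∧ 0 < (x j).2 := fun j =>
    hm _ (Multiset.mem_map_of_mem _ (Finset.mem_univ_val j))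
  have : ∀ j, Module.Finite k (k[X] ⧸ Ideal.span {(x j).1 ^ (x j).2}) := fun j =>
    ((hx j).1.pow _).finite_quotient
  have hd : Module.finrank k (∀ j, k[X] ⧸ Ideal.span {(x j).1 ^ (x j).2}) = n := by
    rw [Module.finrank_pi_fintype, ← hn, Multiset.map_map]
    exact Finset.sum_congr rfl fun i _ => by
      rw [finrank_quotient_span_eq_natDegree, natDegree_pow]; rfl
  let b : (∀ j, k[X] ⧸ Ideal.span {(x j).1 ^ (x j).2}) ≃ₗ[k] (Fin n → k) :=
    (Module.finBasisOfFinrankEq k _ hd).equivFun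
  let f : (Fin n → k) →ₗ[k] (Fin n → k) := b.toLinearMap ∘ₗ
    (Algebra.lsmul k k (∀ j, k[X] ⧸ Ideal.span {(x j).1 ^ (x j).2}) (X : k[X])) ∘ₗ
      b.symm.toLinearMap
  refine ⟨LinearMap.toMatrix' f, hm, s, x, rfl, ⟨LinearEquiv.ofAEval _ b.symm ?_⟩⟩
  intro v
  rw [Matrix.toLin'_toMatrix']
  exact b.symm_apply_apply _

/-- Discarding trivial factors of a product of cyclic modules. -/
theorem nonempty_linearEquiv_pi_subtype {R ι : Type*} [Ring R] (M : ι → Type*)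
    [∀ i, AddCommGroup (M i)] [∀ i, Module R (M i)] (P : ι → Prop)
    (h : ∀ i, ¬ P i → Subsingleton (M i)) :
    Nonempty ((∀ i, M i) ≃ₗ[R] ∀ i : {i // P i}, M i) := by
  classical
  refine ⟨LinearEquiv.ofBijective (LinearMap.pi fun i => LinearMap.proj i.1) ⟨?_, ?_⟩⟩
  · intro u v huv
    ext i
    by_cases hi : P i
    · exact congrFun huv ⟨i, hi⟩
    · have := h i hi
      exact Subsingleton.elim _ _
  · intro v
    exact ⟨fun i => if hi : P i then v ⟨i, hi⟩ else 0, by ext i; simp [i.2]⟩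

theorem exists_hasElemDiv {n : ℕ} (A : Matrix (Fin n) (Fin n) k) : ∃ m, HasElemDiv A m := by
  classical
  have ht := Module.AEval.isTorsion_of_finiteDimensional k (Fin n → k) (Matrix.toLin' A)
  obtain ⟨ι, _, p, hp, e, ⟨φ⟩⟩ := Module.equiv_directSum_of_isTorsion ht
  let x : ι → k[X] × ℕ := fun i => (normalize (p i), e i)
  have hx : ∀ i, Ideal.span {p i ^ e i} = Ideal.span {(x i).1 ^ (x i).2} := fun i => by
    rw [Ideal.span_singleton_eq_span_singleton]
    exact (associated_normalize (p i)).pow_pow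
  obtain ⟨ψ⟩ := nonempty_linearEquiv_pi_subtype (R := k[X])
    (fun i => k[X] ⧸ Ideal.span {(x i).1 ^ (x i).2}) (fun i => 0 < e i) fun i hi => by
      rw [Submodule.Quotient.subsingleton_iff, Ideal.eq_top_iff_one, Ideal.mem_span_singleton]
      simp only [x, Nat.eq_zero_of_not_pos hi, pow_zero, dvd_refl]
  let σ := Fintype.equivFin {i // 0 < e i}
  refine ⟨Multiset.map (fun j => x (σ.symm j).1) Finset.univ.val, ?_, _, _, rfl, ⟨?_⟩⟩
  · intro y hy
    obtain ⟨j, -, rfl⟩ := Multiset.mem_map.1 hy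
    exact ⟨Polynomial.monic_normalize (hp _).ne_zero,
      (associated_normalize _).irreducible (hp _), (σ.symm j).2⟩
  · exact (φ.trans (DirectSum.linearEquivFunOnFintype k[X] ι _)).trans
      ((LinearEquiv.piCongrRight fun i => Submodule.quotEquivOfEq _ _ (hx i)).trans
        (ψ.trans (cyclicCongr (x := fun i : {i // 0 < e i} => x i.1) σ fun i => by simp)))

theorem hasElemDiv_of_rank_eq {n : ℕ} {A : Matrix (Fin n) (Fin n) k} {m : Multiset (k[X] × ℕ)}
    (hm : IsPrimePowers m) (h : ∀ π : k[X], π.Monic → Irreducible π → ∀ j,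
      (aeval A (π ^ j)).rank = (m.map (primeRank π j)).sum) : HasElemDiv A m := by
  obtain ⟨m', h'⟩ := exists_hasElemDiv A
  rwa [hm.eq_of_sum_primeRank h'.1 fun π h1 h2 j => by rw [← h π h1 h2, h'.rank_eq h1 h2]]

theorem HasElemDiv.of_similar {n : ℕ} {A B : Matrix (Fin n) (Fin n) k} {m : Multiset (k[X] × ℕ)}
    (hA : HasElemDiv A m) (P : GL (Fin n) k) (h : P.val * A = B * P.val) : HasElemDiv B m := by
  refine hasElemDiv_of_rank_eq hA.1 fun π h1 h2 j => ?_
  have h3 : ∀ a : k[X], P.val * aeval A a = aeval B a * P.val := fun a => by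
    induction a using Polynomial.induction_on' with
    | add p q hp hq => simp [mul_add, add_mul, hp, hq]
    | monomial i c =>
      have : SemiconjBy P.val A B := h
      rw [aeval_monomial, aeval_monomial, ← mul_assoc, ← (Algebra.commutes c P.val), mul_assoc,
        (this.pow_right i).eq, mul_assoc]
  have hP := (Matrix.isUnit_iff_isUnit_det _).1 P.isUnit
  rw [← hA.rank_eq h1 h2, ← Matrix.rank_mul_eq_left_of_isUnit_det P.val (aeval B (π ^ j)) hP, ← h3,
    Matrix.rank_mul_eq_right_of_isUnit_det _ _ hP]

theorem HasElemDiv.degree_eq {n : ℕ} {A : Matrix (Fin n) (Fin n) k} {m : Multiset (k[X] × ℕ)}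
    (hA : HasElemDiv A m) : (m.map fun x => x.2 * x.1.natDegree).sum = n := by
  have h := hA.rank_eq monic_X irreducible_X 0
  rw [pow_zero, map_one, Matrix.rank_one, Fintype.card_fin] at h
  refine Eq.trans (congrArg Multiset.sum (Multiset.map_congr rfl fun x _ => ?_)) h.symm
  simp only [primeRank, Nat.sub_zero, ite_self]

end ElementaryDivisors

/-! ### Class sequences -/
section ClassSequences
variable {k : Type*} [Field k]

open Classical in
/-- The sequence of polynomials attached to a multiset of elementary divisors: the `i`-th one is
the product of the `p` over the pairs `(p, i)` in the multiset. -/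
noncomputable def divSeq (m : Multiset (k[X] × ℕ)) (i : ℕ) : k[X] :=
  ((m.filter fun x => x.2 = i).map Prod.fst).prod

theorem isClassSequence_iff {n : ℕ} {A : Matrix (Fin n) (Fin n) k} {f : ℕ → k[X]} :
    IsClassSequence A f ↔ ∃ m, HasElemDiv A m ∧ f = divSeq m := by
  have key : ∀ (s : ℕ) (x : Fin s → k[X] × ℕ) (i : ℕ),
      divSeq (Multiset.map x Finset.univ.val) i = ∏ j with (x j).2 = i, (x j).1 := by
    intro s x i
    rw [divSeq, Multiset.filter_map, Multiset.map_map, Finset.prod, Finset.filter_val]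
    congr 2
  constructor
  · rintro ⟨s, p, e, h1, ⟨φ⟩, h2⟩
    refine ⟨Multiset.map (fun j => (p j, e j)) Finset.univ.val, ⟨?_, s, _, rfl,
      ⟨φ.trans (DirectSum.linearEquivFunOnFintype k[X] (Fin s) _)⟩⟩, ?_⟩
    · intro y hy
      obtain ⟨j, -, rfl⟩ := Multiset.mem_map.1 hy
      exact h1 j
    · ext1 i
      rw [key, h2]
  · rintro ⟨m, ⟨hm, s, x, rfl, ⟨φ⟩⟩, rfl⟩
    exact ⟨s, fun j => (x j).1, fun j => (x j).2,
      fun j => hm _ (Multiset.mem_map_of_mem _ (Finset.mem_univ_val j)),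
      ⟨φ.trans (DirectSum.linearEquivFunOnFintype k[X] (Fin s) _).symm⟩, key s x⟩

theorem IsPrimePowers.divSeq_injective {m m' : Multiset (k[X] × ℕ)} (hm : IsPrimePowers m)
    (hm' : IsPrimePowers m') (h : divSeq m = divSeq m') : m = m' := by
  classical
  have key : ∀ {m : Multiset (k[X] × ℕ)}, IsPrimePowers m → ∀ i,
      UniqueFactorizationMonoid.normalizedFactors (divSeq m i) =
        (m.filter fun x => x.2 = i).map Prod.fst := by
    intro m hm i
    have hx : ∀ a ∈ (m.filter fun x => x.2 = i).map Prod.fst, a.Monic ∧ Irreducible a := by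
      intro a ha
      obtain ⟨x, hx, rfl⟩ := Multiset.mem_map.1 ha
      exact ⟨(hm x (Multiset.mem_of_mem_filter hx)).1, (hm x (Multiset.mem_of_mem_filter hx)).2.1⟩
    have h1 := UniqueFactorizationMonoid.normalizedFactors_prod_eq
      ((m.filter fun x => x.2 = i).map Prod.fst) fun a ha => (hx a ha).2
    rw [Multiset.map_congr rfl fun a ha => (hx a ha).1.normalize_eq_self, Multiset.map_id'] at h1
    rw [← h1, divSeq]
  have count_eq : ∀ (m : Multiset (k[X] × ℕ)) (π : k[X]) (i : ℕ), m.count (π, i) =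
      ((m.filter fun x => x.2 = i).map Prod.fst).count π := by
    intro m π i
    induction m using Multiset.induction_on with
    | empty => simp
    | cons x m ih =>
      obtain ⟨p, e⟩ := x
      by_cases he : e = i
      · subst he
        rw [Multiset.filter_cons_of_pos (p := fun x : k[X] × ℕ => x.2 = e) m rfl, Multiset.map_cons,
          Multiset.count_cons, Multiset.count_cons, ih]
        simp
      · rw [Multiset.filter_cons_of_neg (p := fun x : k[X] × ℕ => x.2 = i) m he,
          Multiset.count_cons_of_ne (by simp [Ne.symm he]), ih]
  ext ⟨π, i⟩
  rw [count_eq, count_eq, ← key hm, ← key hm', h]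

theorem monic_divSeq {m : Multiset (k[X] × ℕ)} (hm : IsPrimePowers m) (i : ℕ) :
    (divSeq m i).Monic :=
  monic_multiset_prod_of_monic _ _ fun x hx => (hm x (Multiset.mem_of_mem_filter hx)).1

theorem divSeq_zero {m : Multiset (k[X] × ℕ)} (hm : IsPrimePowers m) : divSeq m 0 = 1 := by
  rw [divSeq, Multiset.filter_eq_nil.2 fun x hx => (hm x hx).2.2.ne']
  rfl

open Classical in
theorem divSeq_add (m m' : Multiset (k[X] × ℕ)) (i : ℕ) :
    divSeq (m + m') i = divSeq m i * divSeq m' i := by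
  simp [divSeq]

theorem divSeq_map (τ : k[X] →* k[X]) (m : Multiset (k[X] × ℕ)) (i : ℕ) :
    divSeq (m.map fun x => (τ x.1, x.2)) i = τ (divSeq m i) := by
  rw [divSeq, divSeq, map_multiset_prod, Multiset.filter_map, Multiset.map_map, Multiset.map_map]
  rfl

open Classical in
theorem divSeq_map_prodMk (s : Multiset k[X]) (i j : ℕ) :
    divSeq (s.map fun p => (p, j)) i = if j = i then s.prod else 1 := by
  rw [divSeq]
  split_ifs with h
  · rw [Multiset.filter_eq_self.2 (by simp [h]), Multiset.map_map]
    exact congrArg _ (Multiset.map_id' s)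
  · rw [Multiset.filter_eq_nil.2 (by simp [h])]
    rfl

theorem sum_degree_map_prodMk {s : Multiset k[X]} (hs : ∀ p ∈ s, p ≠ 0) (j : ℕ) :
    ((s.map fun p => (p, j)).map fun x => x.2 * x.1.natDegree).sum = j * s.prod.natDegree := by
  rw [natDegree_multiset_prod _ fun h => hs 0 h rfl, Multiset.map_map,
    ← Multiset.sum_map_mul_left]
  rfl

/-- Every sequence of monic polynomials, eventually equal to `1`, comes from a multiset of
elementary divisors. -/
theorem exists_divSeq_eq {f : ℕ → k[X]} (hf : ∀ i, (f i).Monic) (I : Finset ℕ) (h0 : 0 ∉ I)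
    (hI : ∀ i ∉ I, f i = 1) : ∃ m, IsPrimePowers m ∧ divSeq m = f ∧
      (m.map fun x => x.2 * x.1.natDegree).sum = ∑ i ∈ I, i * (f i).natDegree := by
  classical
  induction I using Finset.induction_on generalizing f with
  | empty =>
    refine ⟨0, by simp [IsPrimePowers], ?_, by simp⟩
    ext1 i
    rw [hI i (by simp)]
    simp [divSeq]
  | insert j I hj ih =>
    obtain ⟨m, hm, h1, h2⟩ := ih (f := Function.update f j 1)
      (fun i => by
        by_cases h : i = j
        · subst h; simp
        · simp [h, hf i]) (fun h => h0 (Finset.mem_insert_of_mem h)) (fun i hi => by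
        by_cases h : i = j
        · subst h; simp
        · simp only [Function.update_of_ne h]
          exact hI i (by simp [h, hi]))
    have hs : ∀ p ∈ UniqueFactorizationMonoid.normalizedFactors (f j), p.Monic ∧ Irreducible p :=
      fun p hp => ⟨by
        rw [← UniqueFactorizationMonoid.normalize_normalized_factor p hp]
        exact Polynomial.monic_normalize
          (UniqueFactorizationMonoid.ne_zero_of_mem_normalizedFactors hp),
        UniqueFactorizationMonoid.irreducible_of_normalized_factor p hp⟩
    have hp : (UniqueFactorizationMonoid.normalizedFactors (f j)).prod = f j := by
      rw [UniqueFactorizationMonoid.prod_normalizedFactors_eq (hf j).ne_zero,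
        (hf j).normalize_eq_self]
    refine ⟨m + (UniqueFactorizationMonoid.normalizedFactors (f j)).map fun p => (p, j),
      ?_, ?_, ?_⟩
    · intro x hx
      rcases Multiset.mem_add.1 hx with hx | hx
      · exact hm x hx
      · obtain ⟨p, hp, rfl⟩ := Multiset.mem_map.1 hx
        exact ⟨(hs p hp).1, (hs p hp).2, Nat.pos_of_ne_zero fun h => h0 (by simp [← h])⟩
    · ext1 i
      rw [divSeq_add, h1, divSeq_map_prodMk, hp]
      by_cases h : i = j
      · subst h; simp
      · simp [h, Ne.symm h]
    · rw [Multiset.map_add, Multiset.sum_add, h2,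
        sum_degree_map_prodMk fun p hp => (hs p hp).1.ne_zero, hp, Finset.sum_insert hj, add_comm]
      congr 1
      refine Finset.sum_congr rfl fun i hi => ?_
      rw [Function.update_of_ne (ne_of_mem_of_not_mem hi hj)]

theorem IsClassSequence.unique {n : ℕ} {A : Matrix (Fin n) (Fin n) k} {f g : ℕ → k[X]}
    (hf : IsClassSequence A f) (hg : IsClassSequence A g) : f = g := by
  obtain ⟨m, hm, rfl⟩ := isClassSequence_iff.1 hf
  obtain ⟨m', hm', rfl⟩ := isClassSequence_iff.1 hg
  rw [hm.unique hm']

theorem exists_isClassSequence {n : ℕ} (A : Matrix (Fin n) (Fin n) k) :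
    ∃ f, IsClassSequence A f := by
  obtain ⟨m, hm⟩ := exists_hasElemDiv A
  exact ⟨_, isClassSequence_iff.2 ⟨m, hm, rfl⟩⟩

theorem IsClassSequence.similar {n : ℕ} {A B : Matrix (Fin n) (Fin n) k} {f : ℕ → k[X]}
    (hA : IsClassSequence A f) (hB : IsClassSequence B f) :
    ∃ P : GL (Fin n) k, P.val * A = B * P.val := by
  obtain ⟨m, hm, rfl⟩ := isClassSequence_iff.1 hA
  obtain ⟨m', hm', h⟩ := isClassSequence_iff.1 hB
  obtain rfl := hm.1.divSeq_injective hm'.1 h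
  exact hm.similar hm'

theorem IsClassSequence.of_similar {n : ℕ} {A B : Matrix (Fin n) (Fin n) k} {f : ℕ → k[X]}
    (hA : IsClassSequence A f) (P : GL (Fin n) k) (h : P.val * A = B * P.val) :
    IsClassSequence B f := by
  obtain ⟨m, hm, rfl⟩ := isClassSequence_iff.1 hA
  exact isClassSequence_iff.2 ⟨m, hm.of_similar P h, rfl⟩

theorem IsClassSequence.monic {n : ℕ} {A : Matrix (Fin n) (Fin n) k} {f : ℕ → k[X]}
    (hA : IsClassSequence A f) (i : ℕ) : (f i).Monic := by
  obtain ⟨m, hm, rfl⟩ := isClassSequence_iff.1 hA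
  exact monic_divSeq hm.1 i

theorem IsClassSequence.zero {n : ℕ} {A : Matrix (Fin n) (Fin n) k} {f : ℕ → k[X]}
    (hA : IsClassSequence A f) : f 0 = 1 := by
  obtain ⟨m, hm, rfl⟩ := isClassSequence_iff.1 hA
  exact divSeq_zero hm.1

theorem HasElemDiv.coeff_zero_ne_zero {n : ℕ} {A : Matrix (Fin n) (Fin n) k}
    {m : Multiset (k[X] × ℕ)} (hA : HasElemDiv A m) (hu : IsUnit A) :
    ∀ x ∈ m, x.1.coeff 0 ≠ 0 := by
  classical
  intro x hx h0
  -- as `A` has full rank, no elementary divisor is a power of `X`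
  have h := sum_primeRank_eq_add m X 0
  rw [← hA.rank_eq monic_X irreducible_X, ← hA.rank_eq monic_X irreducible_X, pow_zero, map_one,
    Matrix.rank_one, zero_add, pow_one, aeval_X, Matrix.rank_of_isUnit A hu, natDegree_X, mul_one,
    left_eq_add, Multiset.countP_eq_zero] at h
  refine h x hx ⟨?_, (hA.1 x hx).2.2⟩
  exact (eq_of_monic_of_associated monic_X (hA.1 x hx).1
    ((irreducible_X.dvd_irreducible_iff_associated (hA.1 x hx).2.1).1 (X_dvd_iff.2 h0))).symm

theorem HasElemDiv.isUnit {n : ℕ} {A : Matrix (Fin n) (Fin n) k}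
    {m : Multiset (k[X] × ℕ)} (hA : HasElemDiv A m) (h : ∀ x ∈ m, x.1.coeff 0 ≠ 0) :
    IsUnit A := by
  classical
  have h1 := sum_primeRank_eq_add m X 0
  rw [← hA.rank_eq monic_X irreducible_X, ← hA.rank_eq monic_X irreducible_X, pow_zero, map_one,
    Matrix.rank_one, zero_add, pow_one, aeval_X, natDegree_X, mul_one,
    Multiset.countP_eq_zero.2 fun x hx hx' => h x hx (by rw [hx'.1, coeff_X_zero]), add_zero,
    Fintype.card_fin] at h1
  have h2 : LinearMap.range (Matrix.toLin' A) = ⊤ := by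
    apply Submodule.eq_top_of_finrank_eq
    rw [Module.finrank_fin_fun]
    exact h1.symm
  exact Matrix.mulVec_surjective_iff_isUnit.1 (LinearMap.range_eq_top.1 h2)

theorem coeff_zero_multiset_prod (s : Multiset k[X]) :
    s.prod.coeff 0 = (s.map fun p => p.coeff 0).prod := by
  exact map_multiset_prod (constantCoeff : k[X] →+* k) s

theorem IsClassSequence.coeff_zero_ne_zero {n : ℕ} {A : Matrix (Fin n) (Fin n) k} {f : ℕ → k[X]}
    (hA : IsClassSequence A f) (hu : IsUnit A) (i : ℕ) : (f i).coeff 0 ≠ 0 := by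
  obtain ⟨m, hm, rfl⟩ := isClassSequence_iff.1 hA
  rw [divSeq, coeff_zero_multiset_prod]
  intro h
  rw [Multiset.prod_eq_zero_iff, Multiset.mem_map] at h
  obtain ⟨p, hp, h0⟩ := h
  obtain ⟨x, hx, rfl⟩ := Multiset.mem_map.1 hp
  exact hm.coeff_zero_ne_zero hu x (Multiset.mem_of_mem_filter hx) h0

theorem IsClassSequence.isUnit {n : ℕ} {A : Matrix (Fin n) (Fin n) k} {f : ℕ → k[X]}
    (hA : IsClassSequence A f) (h : ∀ i, (f i).coeff 0 ≠ 0) : IsUnit A := by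
  classical
  obtain ⟨m, hm, rfl⟩ := isClassSequence_iff.1 hA
  refine hm.isUnit fun x hx h0 => h x.2 ?_
  rw [divSeq, coeff_zero_multiset_prod, Multiset.prod_eq_zero_iff, Multiset.mem_map]
  exact ⟨x.1, Multiset.mem_map_of_mem _ (Multiset.mem_filter.2 ⟨hx, rfl⟩), h0⟩

/-- A way of computing the class sequence of a matrix `A'` from that of `A`: a multiplicative map
`τ` on polynomials which matches the primes occurring in the two modules in such a way that the
ranks agree. -/
theorem IsClassSequence.transfer {n : ℕ} {A A' : Matrix (Fin n) (Fin n) k} {f : ℕ → k[X]}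
    (hA : IsClassSequence A f) (τ : k[X] →* k[X]) (good : k[X] → Prop)
    (hgood : ∀ i, ∀ p, p ∣ f i → good p)
    (hτ : ∀ p : k[X], good p → p.Monic → Irreducible p →
      (τ p).Monic ∧ Irreducible (τ p) ∧ (τ p).natDegree = p.natDegree)
    (h : ∀ π : k[X], π.Monic → Irreducible π → ∃ ρ : k[X], ρ.Monic ∧ Irreducible ρ ∧
      (∀ p, good p → p.Monic → (τ p = π ↔ p = ρ)) ∧
      ∀ j, (aeval A' (π ^ j)).rank = (aeval A (ρ ^ j)).rank) :
    IsClassSequence A' fun i => τ (f i) := by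
  classical
  obtain ⟨m, hm, rfl⟩ := isClassSequence_iff.1 hA
  have hg : ∀ x ∈ m, good x.1 := fun x hx =>
    hgood x.2 x.1 (Multiset.dvd_prod (Multiset.mem_map_of_mem _ (Multiset.mem_filter.2 ⟨hx, rfl⟩)))
  refine isClassSequence_iff.2 ⟨m.map fun x => (τ x.1, x.2), hasElemDiv_of_rank_eq ?_ ?_,
    funext fun i => (divSeq_map τ m i).symm⟩
  · intro y hy
    obtain ⟨x, hx, rfl⟩ := Multiset.mem_map.1 hy
    obtain ⟨h1, h2, -⟩ := hτ x.1 (hg x hx) (hm.1 x hx).1 (hm.1 x hx).2.1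
    exact ⟨h1, h2, (hm.1 x hx).2.2⟩
  · intro π h1 h2 j
    obtain ⟨ρ, h3, h4, h5, h6⟩ := h π h1 h2
    rw [h6, hm.rank_eq h3 h4, Multiset.map_map]
    refine congrArg _ (Multiset.map_congr rfl fun x hx => ?_)
    simp only [primeRank, Function.comp_apply, h5 x.1 (hg x hx) (hm.1 x hx).1,
      (hτ x.1 (hg x hx) (hm.1 x hx).1 (hm.1 x hx).2.1).2.2]

end ClassSequences

/-! ### Reciprocals of polynomials and scaling of roots -/
section Operations
variable {k : Type*} [Field k]

theorem irreducible_of_map_irreducible (τ : k[X] →* k[X]) {p : k[X]} (hp : p ≠ 0)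
    (h : ∀ a, a ∣ p → (τ a).natDegree = a.natDegree) (hτ : Irreducible (τ p)) :
    Irreducible p := by
  have hd : ∀ a, a ∣ p → IsUnit (τ a) → IsUnit a := fun a ha hu => by
    have ha0 : a ≠ 0 := fun h0 => hp (by rw [h0] at ha; exact zero_dvd_iff.1 ha)
    rw [isUnit_iff_degree_eq_zero, degree_eq_natDegree ha0, ← h a ha,
      natDegree_eq_zero_of_isUnit hu]
    rfl
  refine ⟨fun hu => hτ.not_isUnit (hu.map τ), fun a b hab => ?_⟩
  rcases hτ.isUnit_or_isUnit (by rw [hab, map_mul]) with h' | h'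
  · exact Or.inl (hd a ⟨b, hab⟩ h')
  · exact Or.inr (hd b ⟨a, by rw [hab, mul_comm]⟩ h')

/-- The reciprocal polynomial, as a multiplicative map. -/
noncomputable def reciprocalHom (k : Type*) [Field k] : k[X] →* k[X] where
  toFun := reciprocal
  map_one' := by simp [reciprocal, ← C_1, -map_one]
  map_mul' f g := by
    rw [reciprocal, reciprocal, reciprocal, mul_coeff_zero, mul_inv, reverse_mul_of_domain, C_mul]
    ring

theorem natDegree_reciprocal {f : k[X]} (h : f.coeff 0 ≠ 0) :
    (reciprocal f).natDegree = f.natDegree := by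
  rw [reciprocal, natDegree_C_mul (inv_ne_zero h), reverse_natDegree,
    natTrailingDegree_eq_zero.2 (Or.inr h), Nat.sub_zero]

theorem coeff_reciprocal (f : k[X]) {i : ℕ} (hi : i ≤ f.natDegree) :
    (reciprocal f).coeff i = (f.coeff 0)⁻¹ * f.coeff (f.natDegree - i) := by
  rw [reciprocal, coeff_C_mul, coeff_reverse, revAt_le hi]

theorem monic_reciprocal {f : k[X]} (h : f.coeff 0 ≠ 0) : (reciprocal f).Monic := by
  rw [Monic, leadingCoeff, natDegree_reciprocal h, coeff_reciprocal f le_rfl, Nat.sub_self,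
    inv_mul_cancel₀ h]

theorem coeff_zero_reciprocal {f : k[X]} (hf : f.Monic) :
    (reciprocal f).coeff 0 = (f.coeff 0)⁻¹ := by
  rw [coeff_reciprocal f (Nat.zero_le _), Nat.sub_zero, coeff_natDegree, hf.leadingCoeff, mul_one]

theorem reciprocal_reciprocal {f : k[X]} (hf : f.Monic) (h : f.coeff 0 ≠ 0) :
    reciprocal (reciprocal f) = f := by
  ext i
  rcases le_or_gt i f.natDegree with hi | hi
  · rw [coeff_reciprocal _ (by rwa [natDegree_reciprocal h]), coeff_zero_reciprocal hf,
      natDegree_reciprocal h, coeff_reciprocal _ (Nat.sub_le _ _), Nat.sub_sub_self hi, inv_inv,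
      mul_inv_cancel_left₀ h]
  · have h' : (reciprocal f).coeff 0 ≠ 0 := by
      rw [coeff_zero_reciprocal hf]
      exact inv_ne_zero h
    rw [coeff_eq_zero_of_natDegree_lt hi, coeff_eq_zero_of_natDegree_lt]
    rwa [natDegree_reciprocal h', natDegree_reciprocal h]

theorem coeff_zero_ne_zero_of_dvd {f g : k[X]} (h : f.coeff 0 ≠ 0) (hg : g ∣ f) :
    g.coeff 0 ≠ 0 := by
  obtain ⟨c, rfl⟩ := hg
  rw [mul_coeff_zero] at h
  exact left_ne_zero_of_mul h

theorem irreducible_reciprocal {f : k[X]} (hf : f.Monic) (h : f.coeff 0 ≠ 0)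
    (hi : Irreducible f) : Irreducible (reciprocal f) := by
  have h' : (reciprocal f).coeff 0 ≠ 0 := by
    rw [coeff_zero_reciprocal hf]
    exact inv_ne_zero h
  refine irreducible_of_map_irreducible (reciprocalHom k) (monic_reciprocal h).ne_zero
    (fun a ha => natDegree_reciprocal (coeff_zero_ne_zero_of_dvd h' ha)) ?_
  change Irreducible (reciprocal (reciprocal f))
  rwa [reciprocal_reciprocal hf h]

/-- Multiplication of the roots of a polynomial by a scalar, as a multiplicative map. -/
noncomputable def scaleRootsHom (c : k) : k[X] →* k[X] where
  toFun f := f.scaleRoots c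
  map_one' := one_scaleRoots c
  map_mul' f g := mul_scaleRoots_of_noZeroDivisors f g c

theorem scaleRoots_scaleRoots_inv (f : k[X]) {c : k} (hc : c ≠ 0) :
    (f.scaleRoots c).scaleRoots c⁻¹ = f := by
  rw [← scaleRoots_mul, mul_inv_cancel₀ hc, scaleRoots_one]

theorem scaleRoots_inv_scaleRoots (f : k[X]) {c : k} (hc : c ≠ 0) :
    (f.scaleRoots c⁻¹).scaleRoots c = f := by
  rw [← scaleRoots_mul, inv_mul_cancel₀ hc, scaleRoots_one]

theorem irreducible_scaleRoots {f : k[X]} {c : k} (hc : c ≠ 0) (hi : Irreducible f) :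
    Irreducible (f.scaleRoots c) := by
  refine irreducible_of_map_irreducible (scaleRootsHom c⁻¹) (scaleRoots_ne_zero hi.ne_zero c)
    (fun a _ => natDegree_scaleRoots a c⁻¹) ?_
  change Irreducible ((f.scaleRoots c).scaleRoots c⁻¹)
  rwa [scaleRoots_scaleRoots_inv f hc]

theorem reciprocal_scaleRoots (f : k[X]) {c : k} (hc : c ≠ 0) :
    reciprocal (f.scaleRoots c) = (reciprocal f).scaleRoots c⁻¹ := by
  by_cases h : f.coeff 0 = 0
  · simp [reciprocal, h]
  ext i
  rcases le_or_gt i f.natDegree with hi | hi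
  · rw [coeff_reciprocal _ (by rwa [natDegree_scaleRoots]), coeff_scaleRoots, coeff_scaleRoots,
      coeff_scaleRoots, coeff_reciprocal _ hi, natDegree_scaleRoots, natDegree_reciprocal h,
      Nat.sub_sub_self hi, Nat.sub_zero, mul_inv, ← inv_pow, ← Nat.sub_add_cancel hi, pow_add,
      Nat.add_sub_cancel, mul_mul_mul_comm, mul_assoc (c⁻¹ ^ _),
      ← mul_pow, inv_mul_cancel₀ hc, one_pow, mul_one]
  · rw [coeff_eq_zero_of_natDegree_lt, coeff_eq_zero_of_natDegree_lt]
    · rwa [natDegree_scaleRoots, natDegree_reciprocal h]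
    · rwa [natDegree_reciprocal, natDegree_scaleRoots]
      rw [coeff_scaleRoots]
      exact mul_ne_zero h (pow_ne_zero _ hc)

theorem reciprocal_map {K : Type*} [Field K] (σ : k →+* K) (f : k[X]) :
    reciprocal (f.map σ) = (reciprocal f).map σ := by
  rw [reciprocal, reciprocal, Polynomial.map_mul, map_C, map_inv₀ σ, coeff_map, reverse, reverse,
    natDegree_map, reflect_map]

/-! ### Class sequences of inverses, scalar multiples and conjugate transposes -/

theorem aeval_inv_reflect {n : ℕ} (g : GL (Fin n) k) (N : ℕ) (f : k[X]) (hf : f.natDegree ≤ N) :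
    aeval (g⁻¹).val (reflect N f) * g.val ^ N = aeval g.val f := by
  refine induction_with_natDegree_le
    (fun f => aeval (g⁻¹).val (reflect N f) * g.val ^ N = aeval g.val f) N ?_ ?_ ?_ f hf
  · simp
  · intro m c _ hm
    rw [reflect_C_mul_X_pow, revAt_le hm, map_mul, map_mul, aeval_C, aeval_C, map_pow, map_pow,
      aeval_X, aeval_X, mul_assoc]
    congr 1
    rw [← Units.val_pow_eq_pow_val, ← Units.val_pow_eq_pow_val, ← Units.val_pow_eq_pow_val,
      ← Units.val_mul]
    congr 1
    rw [inv_pow, inv_mul_eq_iff_eq_mul, ← pow_add, Nat.sub_add_cancel hm]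
  · intro f g _ _ hf hg
    rw [reflect_add, map_add, map_add, add_mul, hf, hg]

theorem rank_aeval_inv {n : ℕ} (g : GL (Fin n) k) {f : k[X]} (h : f.coeff 0 ≠ 0) :
    (aeval (g⁻¹).val (reciprocal f)).rank = (aeval g.val f).rank := by
  have hu : IsUnit (g.val ^ f.natDegree).det :=
    (Matrix.isUnit_iff_isUnit_det _).1 (g.isUnit.pow _)
  rw [← aeval_inv_reflect g f.natDegree f le_rfl, Matrix.rank_mul_eq_left_of_isUnit_det _ _ hu,
    reciprocal, map_mul, aeval_C, ← Algebra.smul_def,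
    Matrix.rank_smul_of_mem_nonZeroDivisors _ (mem_nonZeroDivisors_of_ne_zero (inv_ne_zero h))]
  rfl

theorem IsClassSequence.inv {n : ℕ} {g : GL (Fin n) k} {f : ℕ → k[X]}
    (hg : IsClassSequence g.val f) : IsClassSequence (g⁻¹).val fun i => reciprocal (f i) := by
  refine hg.transfer (reciprocalHom k) (fun p => p.coeff 0 ≠ 0)
    (fun i p hp => coeff_zero_ne_zero_of_dvd (hg.coeff_zero_ne_zero g.isUnit i) hp)
    (fun p h1 h2 h3 => ⟨monic_reciprocal h1, irreducible_reciprocal h2 h1 h3,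
      natDegree_reciprocal h1⟩) fun π h1 h2 => ?_
  by_cases h0 : π.coeff 0 = 0
  · obtain rfl : X = π := eq_of_monic_of_associated monic_X h1
      ((irreducible_X.dvd_irreducible_iff_associated h2).1 (X_dvd_iff.2 h0))
    refine ⟨X, h1, h2, fun p hp hp' => iff_of_false ?_ ?_, fun j => ?_⟩
    · intro h
      have := congrArg (fun q : k[X] => q.coeff 0) h
      change (reciprocal p).coeff 0 = _ at this
      rw [coeff_zero_reciprocal hp', coeff_X_zero] at this
      exact inv_ne_zero hp this
    · rintro rfl
      exact hp coeff_X_zero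
    · rw [map_pow, map_pow, aeval_X, aeval_X, Matrix.rank_of_isUnit _ (g.isUnit.pow _),
        Matrix.rank_of_isUnit _ ((g⁻¹).isUnit.pow _)]
  · refine ⟨reciprocal π, monic_reciprocal h0, irreducible_reciprocal h1 h0 h2,
      fun p hp hp' => ⟨?_, ?_⟩, fun j => ?_⟩
    · rintro rfl
      exact (reciprocal_reciprocal hp' hp).symm
    · rintro rfl
      exact reciprocal_reciprocal h1 h0
    · have hne : (reciprocal π ^ j).coeff 0 ≠ 0 := by
        rw [coeff_zero_eq_eval_zero, eval_pow, ← coeff_zero_eq_eval_zero, coeff_zero_reciprocal h1]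
        exact pow_ne_zero _ (inv_ne_zero h0)
      rw [← rank_aeval_inv g hne, show reciprocal (reciprocal π ^ j) =
        reciprocal (reciprocal π) ^ j from map_pow (reciprocalHom k) _ _,
        reciprocal_reciprocal h1 h0]

theorem rank_aeval_smul {n : ℕ} (A : Matrix (Fin n) (Fin n) k) {c : k} (hc : c ≠ 0) (f : k[X]) :
    (aeval (c • A) (f.scaleRoots c)).rank = (aeval A f).rank := by
  have h := scaleRoots_eval₂_mul_of_commute (p := f) (algebraMap k (Matrix (Fin n) (Fin n) k)) A c
    (Algebra.commutes c A) (fun a b => Algebra.commutes a _)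
  rw [← Algebra.smul_def, ← map_pow, ← Algebra.smul_def] at h
  rw [aeval_def, h, aeval_def, Matrix.rank_smul_of_mem_nonZeroDivisors _
    (mem_nonZeroDivisors_of_ne_zero (pow_ne_zero _ hc))]

theorem IsClassSequence.smul {n : ℕ} {A : Matrix (Fin n) (Fin n) k} {f : ℕ → k[X]}
    (hA : IsClassSequence A f) {c : k} (hc : c ≠ 0) :
    IsClassSequence (c • A) fun i => (f i).scaleRoots c := by
  refine hA.transfer (scaleRootsHom c) (fun _ => True) (fun _ _ _ => trivial)
    (fun p _ h2 h3 => ⟨(monic_scaleRoots_iff c).2 h2, irreducible_scaleRoots hc h3,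
      natDegree_scaleRoots p c⟩) fun π h1 h2 =>
    ⟨π.scaleRoots c⁻¹, (monic_scaleRoots_iff _).2 h1, irreducible_scaleRoots (inv_ne_zero hc) h2,
      fun p _ _ => ⟨?_, ?_⟩, fun j => ?_⟩
  · rintro rfl
    exact (scaleRoots_scaleRoots_inv p hc).symm
  · rintro rfl
    exact scaleRoots_inv_scaleRoots π hc
  · rw [← rank_aeval_smul A hc]
    conv_lhs => rw [← scaleRoots_inv_scaleRoots π hc]
    rw [show (π.scaleRoots c⁻¹ ^ j).scaleRoots c = (π.scaleRoots c⁻¹).scaleRoots c ^ j from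
      map_pow (scaleRootsHom c) _ _]

theorem rank_map_ringHom {n : ℕ} (σ : k →+* k) (A : Matrix (Fin n) (Fin n) k) :
    (A.map σ).rank = A.rank := by
  obtain ⟨V, W, e, hV, hW, h⟩ := A.exists_rank_normal_form
  have h' : V.map σ * A.map σ * W.map σ = V * A * W := by
    rw [← Matrix.map_mul, ← Matrix.map_mul, h, ← Matrix.submatrix_map, Matrix.fromBlocks_map,
      Matrix.map_one _ (map_zero σ) (map_one σ), Matrix.map_zero _ (map_zero σ),
      Matrix.map_zero _ (map_zero σ), Matrix.map_zero _ (map_zero σ)]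
  have hV' : IsUnit (V.map σ).det := (Matrix.isUnit_iff_isUnit_det _).1 (hV.map σ.mapMatrix)
  have hW' : IsUnit (W.map σ).det := (Matrix.isUnit_iff_isUnit_det _).1 (hW.map σ.mapMatrix)
  rw [Matrix.isUnit_iff_isUnit_det] at hV hW
  rw [← Matrix.rank_mul_eq_right_of_isUnit_det V A hV,
    ← Matrix.rank_mul_eq_left_of_isUnit_det W (V * A) hW, ← h',
    Matrix.rank_mul_eq_left_of_isUnit_det _ _ hW', Matrix.rank_mul_eq_right_of_isUnit_det _ _ hV']

theorem aeval_map_transpose {n : ℕ} (σ : k →+* k) (A : Matrix (Fin n) (Fin n) k) (f : k[X]) :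
    aeval (A.map σ).transpose (f.map σ) = ((aeval A f).map σ).transpose := by
  induction f using Polynomial.induction_on' with
  | add p q hp hq =>
    rw [Polynomial.map_add, map_add, map_add, hp, hq, Matrix.map_add _ (map_add σ),
      Matrix.transpose_add]
  | monomial i c =>
    have hpow : (A ^ i).map σ = A.map σ ^ i := map_pow σ.mapMatrix A i
    rw [map_monomial, aeval_monomial, aeval_monomial, ← Algebra.smul_def, ← Algebra.smul_def,
      ← Matrix.transpose_pow, ← hpow, ← Matrix.transpose_smul]
    congr 1
    ext a b
    simp

/-- Applying a field automorphism to the entries of the transpose of a matrix. -/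
theorem IsClassSequence.map_transpose {n : ℕ} {A : Matrix (Fin n) (Fin n) k} {f : ℕ → k[X]}
    (hA : IsClassSequence A f) (σ : k ≃+* k) :
    IsClassSequence (A.map σ).transpose fun i => (f i).map (σ : k →+* k) := by
  have h1 : ∀ p : k[X], (p.map (σ : k →+* k)).map (σ.symm : k →+* k) = p := fun p => by
    rw [Polynomial.map_map, RingEquiv.symm_comp, Polynomial.map_id]
  have h2 : ∀ p : k[X], (p.map (σ.symm : k →+* k)).map (σ : k →+* k) = p := fun p => by
    rw [Polynomial.map_map, RingEquiv.comp_symm, Polynomial.map_id]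
  have hi : ∀ (σ : k ≃+* k) {p : k[X]}, Irreducible p → Irreducible (p.map (σ : k →+* k)) :=
    fun σ p hp => (MulEquiv.irreducible_iff (mapEquiv σ)).2 hp
  refine hA.transfer (mapRingHom (σ : k →+* k) : k[X] →* k[X]) (fun _ => True)
    (fun _ _ _ => trivial) (fun p _ h3 h4 => ⟨h3.map _, hi σ h4, natDegree_map _⟩)
    fun π h3 h4 => ⟨π.map (σ.symm : k →+* k), h3.map _, hi σ.symm h4, fun p _ _ => ⟨?_, ?_⟩,
      fun j => ?_⟩
  · rintro rfl
    exact (h1 p).symm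
  · rintro rfl
    exact h2 π
  · have := aeval_map_transpose (σ : k →+* k) A (π.map (σ.symm : k →+* k) ^ j)
    rw [Polynomial.map_pow, h2] at this
    change (aeval (A.map (σ : k →+* k)).transpose (π ^ j)).rank = _
    rw [this, Matrix.rank_transpose, rank_map_ringHom]

end Operations

/-! ### Hilbert 90 and norms in finite rings with involution -/
section Involution

theorem exists_pow_isIdempotentElem {R : Type*} [Monoid R] [Finite R] (a x : R) (ha : IsUnit a) :
    ∃ N, 0 < N ∧ a ^ N = 1 ∧ x ^ N * x ^ N = x ^ N := by
  obtain ⟨i, j, hij, h⟩ : ∃ i j : ℕ, i < j ∧ x ^ i = x ^ j := by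
    obtain ⟨i, j, hne, h⟩ := Finite.exists_ne_map_eq_of_infinite fun i : ℕ => x ^ i
    rcases lt_or_gt_of_ne hne with h' | h'
    · exact ⟨i, j, h', h⟩
    · exact ⟨j, i, h', h.symm⟩
  obtain ⟨d, rfl⟩ := Nat.exists_eq_add_of_lt hij
  obtain ⟨u, rfl⟩ := ha
  have hu : 0 < orderOf u := orderOf_pos u
  have h1 : ∀ m, i ≤ m → ∀ t, x ^ (m + t * (d + 1)) = x ^ m := by
    intro m hm t
    induction t with
    | zero => simp
    | succ t ih =>
      obtain ⟨c, rfl⟩ := Nat.exists_eq_add_of_le hm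
      rw [show i + c + (t + 1) * (d + 1) = (i + d + 1) + (c + t * (d + 1)) by ring, pow_add, ← h,
        ← pow_add, ← add_assoc, ih]
  refine ⟨(i + 1) * orderOf u * (d + 1), by positivity, ?_, ?_⟩
  · rw [← Units.val_pow_eq_pow_val, mul_right_comm, mul_comm, pow_mul, pow_orderOf_eq_one, one_pow,
      Units.val_one]
  · rw [← pow_add]
    refine h1 _ ?_ _
    nlinarith [Nat.mul_pos (Nat.succ_pos i) (Nat.mul_pos hu (Nat.succ_pos d)),
      Nat.mul_le_mul_left (i + 1) (Nat.mul_pos hu (Nat.succ_pos d))]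

/-- Let `a, l, l'` be commuting elements of a finite ring, with `l - l'` invertible, and let
`e` be an idempotent power of `1 + a`. Then `1 + a` is invertible on the image of `e` and
nilpotent on the complement, where `l + l' a = (l - l') + l' (1 + a)` is therefore invertible. -/
theorem isUnit_combination {R : Type*} [Ring R] [Finite R] {a l l' e : R} (hl : Commute l a)
    (hl' : Commute l' a) (hll : Commute l l') (hu : IsUnit (l - l')) {N : ℕ} (hN : 0 < N)
    (he : (1 + a) ^ N = e) (hee : e * e = e) :
    IsUnit (e * (1 + a) + (1 - e) * (l + l' * a)) := by
  have ca : Commute (1 + a) a := (Commute.one_left a).add_left (Commute.refl a)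
  have cl : Commute (1 + a) l := (Commute.one_left l).add_left hl.symm
  have cl' : Commute (1 + a) l' := (Commute.one_left l').add_left hl'.symm
  have ea : Commute e a := he ▸ ca.pow_left N
  have el : Commute e l := he ▸ cl.pow_left N
  have el' : Commute e l' := he ▸ cl'.pow_left N
  have e1 : Commute e (1 + a) := (Commute.one_right e).add_right ea
  have ec : Commute e (l + l' * a) := el.add_right (el'.mul_right ea)
  have hz : e * (1 - e) = 0 := by rw [mul_sub, mul_one, hee, sub_self]
  have h0 : ∀ w, (e * (1 + a) + (1 - e) * (l + l' * a)) * w = 0 → w = 0 := by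
    intro w hw
    have h1 : e * w = 0 := by
      have h2 : (1 + a) * (e * w) = 0 := by
        have := congrArg (e * ·) hw
        simp only [mul_zero] at this
        rw [← mul_assoc, mul_add, ← mul_assoc, ← mul_assoc, hee, hz, zero_mul, add_zero, e1.eq,
          mul_assoc] at this
        exact this
      have h3 : (1 + a) ^ N * (e * w) = 0 := by
        rw [← Nat.sub_add_cancel hN, pow_add, Nat.succ_eq_add_one, zero_add, pow_one, mul_assoc,
            h2, mul_zero]
      rwa [he, ← mul_assoc, hee] at h3
    have h2 : (l + l' * a) * w = 0 := by
      have h3 : (1 - e) * ((l + l' * a) * w) = 0 := by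
        rwa [add_mul, e1.eq, mul_assoc, h1, mul_zero, zero_add, mul_assoc] at hw
      rw [sub_mul, one_mul, ← mul_assoc, ec.eq, mul_assoc, h1, mul_zero, sub_zero] at h3
      exact h3
    have h3 : (l - l') * w = (-l' * (1 + a)) * w := by
      rw [← sub_eq_zero, ← sub_mul, ← h2]
      congr 1
      noncomm_ring
    have c1 : Commute (l - l') (-l' * (1 + a)) :=
      (((hll.sub_left (Commute.refl l')).neg_right)).mul_right (cl.symm.sub_left cl'.symm)
    have h4 : ∀ i, (l - l') ^ i * w = (-l' * (1 + a)) ^ i * w := by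
      intro i
      induction i with
      | zero => simp
      | succ i ih =>
        rw [pow_succ, mul_assoc, h3, ← mul_assoc, (c1.pow_left i).eq, mul_assoc, ih, ← mul_assoc,
          ← pow_succ']
    have h5 : (-l' * (1 + a)) ^ N * w = 0 := by
      rw [(cl'.symm.neg_left).mul_pow, he, mul_assoc, h1, mul_zero]
    rw [← h4] at h5
    obtain ⟨v, hv⟩ := (hu.pow N)
    rw [← hv] at h5
    exact (Units.mul_right_eq_zero v).1 h5
  have hinj : Function.Injective fun w => (e * (1 + a) + (1 - e) * (l + l' * a)) * w := by
    intro w w' h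
    rw [← sub_eq_zero]
    apply h0
    rw [mul_sub, sub_eq_zero]
    exact h
  obtain ⟨v, hv⟩ := (Finite.injective_iff_surjective.1 hinj) 1
  have hv' : v * (e * (1 + a) + (1 - e) * (l + l' * a)) = 1 := by
    apply hinj
    dsimp only at hv ⊢
    rw [← mul_assoc, hv, one_mul, mul_one]
  exact ⟨⟨_, v, hv, hv'⟩, rfl⟩

/-- **Hilbert 90** for a finite commutative ring with involution containing an element `l` such
that `l - star l` is invertible. -/
theorem exists_isUnit_eq_star_mul {C : Type*} [CommRing C] [StarRing C] [Finite C] {l : C}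
    (hl : IsUnit (l - star l)) {a : C} (ha : a * star a = 1) :
    ∃ b : C, IsUnit b ∧ b = star b * a := by
  have hua : IsUnit a := IsUnit.of_mul_eq_one _ ha
  obtain ⟨N, hN, haN, hee⟩ := exists_pow_isIdempotentElem a (1 + a) hua
  set e := (1 + a) ^ N with he
  have hse : star e = e := by
    have h1 : star (1 + a) * a = 1 + a := by
      rw [star_add, star_one, add_mul, one_mul, mul_comm (star a), ha, add_comm]
    calc star e = star (1 + a) ^ N * a ^ N := by rw [he, star_pow, haN, mul_one]
      _ = e := by rw [← mul_pow, h1]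
  refine ⟨e * (1 + a) + (1 - e) * (l + star l * a), isUnit_combination (Commute.all _ _)
    (Commute.all _ _) (Commute.all _ _) hl hN he.symm hee, ?_⟩
  simp only [star_add, star_mul, star_sub, star_one, star_star, hse]
  linear_combination (-e - (1 - e) * l) * ha

/-- If every element killed by the norm `y ↦ y * σ y` of an involution `σ` of a finite commutative
group is of the form `b / σ b`, then every fixed element is a norm: the image of the norm and the
group of fixed elements have the same order. -/
theorem exists_mul_map_eq {G : Type*} [CommGroup G] [Finite G] (σ : G →* G)
    (hσ : ∀ x, σ (σ x) = x) (h90 : ∀ a, a * σ a = 1 → ∃ b, b / σ b = a) {h : G}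
    (hh : σ h = h) : ∃ y, y * σ y = h := by
  let N : G →* G := MonoidHom.id G * σ
  let D : G →* G := MonoidHom.id G / σ
  have h1 : N.ker = D.range := by
    ext a
    constructor
    · exact fun ha => h90 a ha
    · rintro ⟨b, rfl⟩
      change b / σ b * σ (b / σ b) = 1
      rw [_root_.map_div, hσ, div_mul_div_cancel, div_self']
  have h2 : N.range ≤ D.ker := by
    rintro _ ⟨y, rfl⟩
    change (y * σ y) / σ (y * σ y) = 1
    rw [map_mul, hσ, mul_comm, div_self']
  have hN := N.ker.card_mul_index
  have hD := D.ker.card_mul_index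
  rw [Subgroup.index_ker] at hN hD
  rw [h1, ← hD, mul_comm] at hN
  have h3 : N.range = D.ker :=
    Subgroup.eq_of_le_of_card_ge h2 (Nat.eq_of_mul_eq_mul_right Nat.card_pos hN).ge
  have h4 : h ∈ D.ker := by
    change h / σ h = 1
    rw [hh, div_self']
  rw [← h3] at h4
  exact h4

/-- In a finite commutative ring with involution containing an element `l` such that
`l - star l` is invertible, every self-adjoint unit is a norm. -/
theorem exists_star_mul_self_eq {C : Type*} [CommRing C] [StarRing C] [Finite C] {l : C}
    (hl : IsUnit (l - star l)) {h : C} (hh : star h = h) (hu : IsUnit h) :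
    ∃ y : C, IsUnit y ∧ star y * y = h := by
  obtain ⟨u, rfl⟩ := hu
  let σ : Cˣ →* Cˣ := (starMulAut : Cˣ ≃* Cˣ).toMonoidHom
  have h90 : ∀ a : Cˣ, a * σ a = 1 → ∃ b, b / σ b = a := fun a ha => by
    obtain ⟨b, ⟨v, rfl⟩, hb⟩ := exists_isUnit_eq_star_mul hl (a := a.val) (congrArg Units.val ha)
    refine ⟨v, ?_⟩
    rw [div_eq_iff_eq_mul, mul_comm]
    exact Units.ext hb
  obtain ⟨y, hy⟩ := exists_mul_map_eq σ (fun x => star_star x) h90 (h := u) (Units.ext hh)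
  exact ⟨y, y.isUnit, by rw [← hy, mul_comm]; rfl⟩

end Involution

/-! ### Unitary similarity -/
section Unitary
open Matrix

theorem isUnit_sub_star {K : Type*} [Field K] [StarRing K] {l : K} (hl : star l ≠ l) :
    IsUnit (l - star l) :=
  (sub_ne_zero.2 hl.symm).isUnit

variable {K : Type*} [Field K] [StarRing K] [Finite K] {n : ℕ}

open scoped IsMulCommutative in
/-- An invertible Hermitian matrix `H` over a finite field with nontrivial involution is of the
form `yᴴ * y`, where `y` commutes with everything that commutes with `H`. The matrix `y` is found
in the commutative algebra generated by `H`. -/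
theorem exists_conjTranspose_mul_self_eq {l : K} (hl : star l ≠ l)
    {H : Matrix (Fin n) (Fin n) K} (hH : Hᴴ = H) (hu : IsUnit H) :
    ∃ y : GL (Fin n) K, y.valᴴ * y.val = H ∧ ∀ g, Commute H g → Commute y.val g := by
  have hsa : star H = H := hH
  have : IsStarNormal H := ⟨by rw [hsa]⟩
  let h : StarAlgebra.adjoin K {H} := ⟨H, StarAlgebra.self_mem_adjoin_singleton K H⟩
  have hh : star h = h := Subtype.ext hsa
  have huh : IsUnit h := by
    have hinj : Function.Injective fun w => h * w := fun w w' hw =>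
      Subtype.ext (hu.mul_left_cancel (congrArg Subtype.val hw))
    obtain ⟨v, hv⟩ := Finite.injective_iff_surjective.1 hinj 1
    exact IsUnit.of_mul_eq_one v hv
  have hl' : IsUnit (algebraMap K (StarAlgebra.adjoin K {H}) l -
      star (algebraMap K (StarAlgebra.adjoin K {H}) l)) := by
    rw [← algebraMap_star_comm, ← map_sub]
    exact (isUnit_sub_star hl).map _
  obtain ⟨y, hy, hyh⟩ := exists_star_mul_self_eq hl' hh huh
  obtain ⟨u, hu⟩ := hy.map (StarAlgebra.adjoin K {H}).subtype
  refine ⟨u, ?_, fun g hg => ?_⟩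
  · rw [hu]
    exact congrArg Subtype.val hyh
  · rw [hu]
    have key : ∀ x ∈ StarAlgebra.adjoin K {H}, Commute x g ∧ Commute (star x) g := by
      intro x hx
      induction hx using StarAlgebra.adjoin_induction with
      | mem x hx =>
        rw [Set.mem_singleton_iff.1 hx, hsa]
        exact ⟨hg, hg⟩
      | algebraMap r =>
        rw [← algebraMap_star_comm]
        exact ⟨Algebra.commutes _ _, Algebra.commutes _ _⟩
      | add x y _ _ h1 h2 =>
        rw [star_add]
        exact ⟨h1.1.add_left h2.1, h1.2.add_left h2.2⟩
      | mul x y _ _ h1 h2 =>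
        rw [star_mul]
        exact ⟨h1.1.mul_left h2.1, h2.2.mul_left h1.2⟩
      | star x _ h1 =>
        rw [star_star]
        exact ⟨h1.2, h1.1⟩
    exact (key y y.2).1

/-- Unitary matrices which are similar are similar under a unitary matrix. -/
theorem exists_unitary_similar {l : K} (hl : star l ≠ l) {g h x : GL (Fin n) K}
    (hg : g.valᴴ * g.val = 1) (hh : h.valᴴ * h.val = 1) (hx : x.val * g.val = h.val * x.val) :
    ∃ u : GL (Fin n) K, u.valᴴ * u.val = 1 ∧ u.val * g.val = h.val * u.val := by
  have hH : (x.valᴴ * x.val)ᴴ = x.valᴴ * x.val := by simp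
  obtain ⟨y, hy, hyg⟩ := exists_conjTranspose_mul_self_eq hl hH
    ((x.isUnit.star).mul x.isUnit)
  -- `xᴴ * x` commutes with `g`
  have hc : Commute (x.valᴴ * x.val) g.val := by
    have h1 : g.val * g.valᴴ = 1 := mul_eq_one_comm.1 hg
    have h2 : g.valᴴ * x.valᴴ = x.valᴴ * h.valᴴ := by
      rw [← conjTranspose_mul, hx, conjTranspose_mul]
    calc x.valᴴ * x.val * g.val = g.val * (g.valᴴ * x.valᴴ) * (h.val * x.val) := by
          rw [← mul_assoc g.val, h1, one_mul, mul_assoc, hx]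
      _ = g.val * x.valᴴ * (h.valᴴ * h.val) * x.val := by rw [h2]; simp only [mul_assoc]
      _ = g.val * (x.valᴴ * x.val) := by rw [hh, mul_one, mul_assoc]
  have hyc : y.val * g.val = g.val * y.val := hyg _ hc
  have hyi : (y⁻¹).val * g.val = g.val * (y⁻¹).val := by
    rw [Units.inv_mul_eq_iff_eq_mul, ← mul_assoc, hyc, mul_assoc, Units.mul_inv, mul_one]
  refine ⟨x * y⁻¹, ?_, ?_⟩
  · have h3 : y.val * (y⁻¹).val = 1 := Units.mul_inv y
    rw [Units.val_mul, conjTranspose_mul, mul_assoc, ← mul_assoc x.valᴴ, ← hy, mul_assoc, h3,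
      mul_one, ← conjTranspose_mul, h3, conjTranspose_one]
  · rw [Units.val_mul, mul_assoc, hyi, ← mul_assoc, hx, mul_assoc]

/-- A matrix preserving a nondegenerate sesquilinear form preserves a nondegenerate Hermitian
form, namely `H z + (H z)ᴴ` for a suitable polynomial `z` in `H⁻¹ Hᴴ`, and is therefore similar to
a unitary matrix. -/
theorem exists_similar_unitary {l : K} (hl : star l ≠ l) {g H : GL (Fin n) K}
    (hg : g.valᴴ * H.val * g.val = H.val) :
    ∃ y : GL (Fin n) K, (y * g * y⁻¹).valᴴ * (y * g * y⁻¹).val = 1 := by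
  -- the unit `a = H⁻¹ Hᴴ` commutes with `g`
  obtain ⟨a, ha⟩ : ∃ a : GL (Fin n) K, H.val * a.val = H.valᴴ :=
    ⟨H⁻¹ * star H, by rw [Units.val_mul, ← mul_assoc, Units.mul_inv, one_mul]; rfl⟩
  have hgH : g.valᴴ * H.valᴴ * g.val = H.valᴴ := by
    have := congrArg conjTranspose hg
    rw [conjTranspose_mul, conjTranspose_mul, conjTranspose_conjTranspose, ← mul_assoc] at this
    exact this
  have hga : Commute g.val a.val := by
    have h1 : g.valᴴ * H.val * (g.val * a.val) = g.valᴴ * H.val * (a.val * g.val) := by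
      rw [← mul_assoc, hg, ha, ← mul_assoc, mul_assoc _ H.val, ha, hgH]
    exact ((g.isUnit.star).mul H.isUnit).mul_left_cancel h1
  obtain ⟨N, hN, haN, hee⟩ := exists_pow_isIdempotentElem a.val (1 + a.val) a.isUnit
  obtain ⟨e, he⟩ : ∃ e, (1 + a.val) ^ N = e := ⟨_, rfl⟩
  rw [he] at hee
  -- the idempotent `e` is self-adjoint with respect to `H`
  have heH : eᴴ * H.val = H.val * e := by
    have h1 : (1 + a.val)ᴴ * H.val = H.val * ((1 + a.val) * (a⁻¹).val) := by
      have h2 : a.valᴴ * H.valᴴ = H.val := by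
        rw [← conjTranspose_mul, ha, conjTranspose_conjTranspose]
      have h3 : a.valᴴ * H.val * a.val = H.val := by rw [mul_assoc, ha, h2]
      rw [add_mul, one_mul, Units.mul_inv, conjTranspose_add, conjTranspose_one, add_mul, one_mul,
        mul_add, mul_one, add_comm, ← (Units.eq_mul_inv_iff_mul_eq a).2 h3]
    have h4 : ∀ i, ((1 + a.val) ^ i)ᴴ * H.val = H.val * ((1 + a.val) * (a⁻¹).val) ^ i := by
      intro i
      induction i with
      | zero => simp
      | succ i ih =>
        rw [pow_succ', conjTranspose_mul, mul_assoc, h1, ← mul_assoc, ih, mul_assoc, ← pow_succ]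
    have h5 : Commute (1 + a.val) (a⁻¹).val :=
      (Commute.one_left _).add_left (by rw [Commute, SemiconjBy, Units.mul_inv, Units.inv_mul])
    have h6 : (a⁻¹).val ^ N = 1 := by
      rw [← Units.val_pow_eq_pow_val, inv_pow, Units.val_eq_one, inv_eq_one]
      exact Units.ext haN
    rw [← he, h4, h5.mul_pow, h6, mul_one]
  have heH' : eᴴ * H.valᴴ = H.valᴴ * e := by
    have := congrArg conjTranspose heH
    rw [conjTranspose_mul, conjTranspose_mul, conjTranspose_conjTranspose] at this
    exact this.symm
  -- `H z + (H z)ᴴ = H (z + a (e + star l • (1 - e)))`, and the second factor is the unit of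
  -- `isUnit_combination`
  let z := e + l • (1 - e)
  let H' := H.val * z + (H.val * z)ᴴ
  have hz : zᴴ * H.valᴴ = H.valᴴ * (e + star l • (1 - e)) := by
    simp only [z, conjTranspose_add, conjTranspose_smul, conjTranspose_sub, conjTranspose_one,
      add_mul, mul_add, sub_mul, mul_sub, smul_mul_assoc, mul_smul_comm, heH', one_mul, mul_one]
  have hH' : H' = H.val * (e * (1 + a.val) + (1 - e) *
      (algebraMap K _ l + algebraMap K _ (star l) * a.val)) := by
    have hea : e * a.val = a.val * e :=
      he ▸ (((Commute.one_left a.val).add_left (Commute.refl a.val)).pow_left N).eq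
    have h1 : H' = H.val * (z + a.val * (e + star l • (1 - e))) := by
      rw [mul_add, ← mul_assoc, ha, ← hz, ← conjTranspose_mul]
    rw [h1, Algebra.algebraMap_eq_smul_one, Algebra.algebraMap_eq_smul_one]
    congr 1
    simp only [z]
    simp only [mul_add, mul_sub, sub_mul, mul_one, one_mul, smul_sub,
      mul_smul_comm, smul_mul_assoc, hea]
    abel
  have hu : IsUnit H' := by
    rw [hH']
    exact H.isUnit.mul (isUnit_combination (Algebra.commutes _ _) (Algebra.commutes _ _)
      (Algebra.commutes _ _) (by rw [← map_sub]; exact (isUnit_sub_star hl).map _) hN he hee)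
  have hgz : Commute g.val z := by
    have h1 : Commute g.val e := he ▸ ((Commute.one_right g.val).add_right hga).pow_right N
    exact h1.add_right (((Commute.one_right g.val).sub_right h1).smul_right l)
  have hgH' : g.valᴴ * H' * g.val = H' := by
    have h1 : g.valᴴ * (H.val * z) * g.val = H.val * z := by
      rw [mul_assoc, mul_assoc, ← hgz.eq, ← mul_assoc H.val, ← mul_assoc, ← mul_assoc, hg]
    have h2 : g.valᴴ * (H.val * z)ᴴ * g.val = (H.val * z)ᴴ := by
      have := congrArg conjTranspose h1
      rw [conjTranspose_mul, conjTranspose_mul, conjTranspose_conjTranspose, ← mul_assoc] at this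
      exact this
    simp only [H', mul_add, add_mul, h1, h2]
  obtain ⟨y, hy, -⟩ := exists_conjTranspose_mul_self_eq hl (H := H') (by
    simp only [H', conjTranspose_add, conjTranspose_conjTranspose, add_comm]) hu
  refine ⟨y, ?_⟩
  have h3 : y.val * (y⁻¹).val = 1 := Units.mul_inv y
  calc (y * g * y⁻¹).valᴴ * (y * g * y⁻¹).val
      = (y⁻¹).valᴴ * (g.valᴴ * (y.valᴴ * y.val) * g.val) * (y⁻¹).val := by
        simp only [Units.val_mul, conjTranspose_mul, mul_assoc]
    _ = (y.val * (y⁻¹).val)ᴴ * (y.val * (y⁻¹).val) := by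
        rw [hy, hgH', ← hy, conjTranspose_mul]
        simp only [mul_assoc]
    _ = 1 := by rw [h3, conjTranspose_one, one_mul]

end Unitary

/-! ### Counting real classes in a central quotient -/
section Counting

theorem isReal_mk_iff {G : Type*} [Group G] {a : G} :
    IsReal (ConjClasses.mk a) ↔ IsConj a a⁻¹ := by
  constructor
  · intro h
    exact ConjClasses.mk_eq_mk_iff_isConj.1 (ConjClasses.mem_carrier_iff_mk_eq.1
      (h a ConjClasses.mem_carrier_mk)).symm
  · intro h g hg
    rw [ConjClasses.mem_carrier_iff_mk_eq, ConjClasses.mk_eq_mk_iff_isConj] at hg ⊢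
    have : IsConj g⁻¹ a⁻¹ := by
      obtain ⟨x, hx⟩ := isConj_iff.1 hg
      exact isConj_iff.2 ⟨x, by rw [← hx]; group⟩
    exact this.trans h.symm

/-- Suppose that the finite group `T` acts on a set `S`, and that `ρ` satisfies
`ρ (t • s) = t⁻¹ • ρ s`. Then the number of orbits of elements `s` with `ρ s ∈ T s` is the average
over `t` of the number of `s` with `ρ s = t • s`. This is Burnside's lemma, because for fixed `s`
the solutions of `ρ s = t • s` form a coset of the stabilizer. -/
theorem card_orbits_mul_card {S T : Type*} [CommGroup T] [Finite T] [MulAction T S] (ρ : S → S)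
    (hρ : ∀ (t : T) s, ρ (t • s) = t⁻¹ • ρ s) (P : Set S) (hP : P.Finite)
    (hPT : ∀ (t : T) s, s ∈ P → t • s ∈ P) {C : Type*} (π : S → C)
    (hπ : ∀ s ∈ P, ∀ s' ∈ P, π s = π s' ↔ ∃ t : T, t • s = s') [Fintype T] :
    Nat.card {c : C // ∃ s ∈ P, π s = c ∧ ∃ t : T, ρ s = t • s} * Nat.card T =
      ∑ t : T, Nat.card {s // s ∈ P ∧ ρ s = t • s} := by
  let X : SubMulAction T S :=
    { carrier := {s | s ∈ P ∧ ∃ t : T, ρ s = t • s}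
      smul_mem' := by
        rintro t s ⟨h1, t', h2⟩
        exact ⟨hPT t s h1, t⁻¹ * t' * t⁻¹, by
          rw [hρ, h2, smul_smul, smul_smul, inv_mul_cancel_right]⟩ }
  have : Finite X := (hP.subset fun s hs => hs.1).to_subtype
  let Ω := Quotient (MulAction.orbitRel T X)
  let F : Ω → {c : C // ∃ s ∈ P, π s = c ∧ ∃ t : T, ρ s = t • s} :=
    Quotient.lift (fun x : X => ⟨π x, x, x.2.1, rfl, x.2.2⟩) (by
      rintro x y ⟨t, ht⟩
      exact Subtype.ext ((hπ y y.2.1 x x.2.1).2 ⟨t, congrArg Subtype.val ht⟩).symm)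
  have hF : Function.Bijective F := by
    constructor
    · intro x y
      induction x using Quotient.inductionOn
      induction y using Quotient.inductionOn
      rename_i x y
      intro h
      obtain ⟨t, ht⟩ := (hπ y y.2.1 x x.2.1).1 (congrArg Subtype.val h).symm
      exact Quotient.sound ⟨t, Subtype.ext ht⟩
    · rintro ⟨_, s, hs, rfl, hs'⟩
      exact ⟨Quotient.mk _ (⟨s, hs, hs'⟩ : X), rfl⟩
  choose c hc using fun x : X => x.2.2
  let e : T × X ≃ T × X :=
    { toFun := fun p => (c p.2 * p.1, p.2)
      invFun := fun p => ((c p.2)⁻¹ * p.1, p.2)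
      left_inv := fun p => by simp
      right_inv := fun p => by simp }
  let e1 : (Σ t : T, MulAction.fixedBy X t) ≃ {p : T × X // p.1 • p.2 = p.2} :=
    { toFun := fun p => ⟨(p.1, p.2.1), p.2.2⟩
      invFun := fun p => ⟨p.1.1, p.1.2, p.2⟩
      left_inv := fun _ => rfl
      right_inv := fun _ => rfl }
  let e2 : {p : T × X // p.1 • p.2 = p.2} ≃ {p : T × X // ρ p.2 = p.1 • (p.2 : S)} :=
    e.subtypeEquiv fun p => by
      change p.1 • p.2 = p.2 ↔ ρ p.2 = (c p.2 * p.1) • (p.2 : S)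
      rw [hc p.2, mul_smul, smul_left_cancel_iff, eq_comm (a := (p.2 : S)), Subtype.ext_iff]
      rfl
  let e3 : {p : T × X // ρ p.2 = p.1 • (p.2 : S)} ≃ (Σ t : T, {s // s ∈ P ∧ ρ s = t • s}) :=
    { toFun := fun p => ⟨p.1.1, p.1.2, p.1.2.2.1, p.2⟩
      invFun := fun p => ⟨(p.1, ⟨p.2.1, p.2.2.1, p.1, p.2.2.2⟩), p.2.2.2⟩
      left_inv := fun _ => rfl
      right_inv := fun _ => rfl }
  have : ∀ t : T, Finite {s // s ∈ P ∧ ρ s = t • s} := fun t =>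
    (hP.subset fun s hs => hs.1 : Set.Finite {s | s ∈ P ∧ ρ s = t • s}).to_subtype
  rw [← Nat.card_sigma, ← Nat.card_congr (Equiv.ofBijective F hF), ← Nat.card_prod]
  exact Nat.card_congr ((MulAction.sigmaFixedByEquivOrbitsProdGroup T X).symm.trans
    (e1.trans (e2.trans e3)))

/-- Let `Q` be the quotient of `G` by the central elements `z t`, `t : T`, and let `cl` classify the
conjugacy classes of `G`. Then the conjugacy classes of `Q` are classified by the `T`-orbits of the
values of `cl`. -/
theorem isConj_map_iff {G Q S T : Type*} [Group G] [Group Q] [Monoid T] [MulAction T S]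
    (φ : G →* Q) (cl : G → S) (z : T → G) (hcl : ∀ g h, cl g = cl h ↔ IsConj g h)
    (hz : ∀ t g, cl (z t * g) = t • cl g) (hφ : Function.Surjective φ)
    (hφz : ∀ g h, φ g = φ h ↔ ∃ t, z t * g = h) (g h : G) :
    IsConj (φ g) (φ h) ↔ ∃ t : T, t • cl g = cl h := by
  constructor
  · intro hgh
    obtain ⟨y, hy⟩ := isConj_iff.1 hgh
    obtain ⟨x, rfl⟩ := hφ y
    rw [← map_mul, ← map_inv, ← map_mul] at hy
    obtain ⟨t, ht⟩ := (hφz _ _).1 hy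
    refine ⟨t, ?_⟩
    rw [← ht, hz, (hcl g _).2 (isConj_iff.2 ⟨x, rfl⟩)]
  · rintro ⟨t, ht⟩
    rw [← hz, hcl] at ht
    rw [(hφz g (z t * g)).2 ⟨t, rfl⟩]
    exact φ.map_isConj ht

/-- The number of real conjugacy classes of a quotient `Q` of `G` by a central subgroup `z T`, when
the conjugacy classes of `G` are classified by an invariant `cl`. -/
theorem card_isReal_mul_card {G Q S T : Type*} [Group G] [Finite G] [Group Q] [CommGroup T]
    [Fintype T] [MulAction T S] (φ : G →* Q) (cl : G → S) (z : T → G) (ρ : S → S)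
    (hcl : ∀ g h, cl g = cl h ↔ IsConj g h) (hz : ∀ t g, cl (z t * g) = t • cl g)
    (hφ : Function.Surjective φ) (hφz : ∀ g h, φ g = φ h ↔ ∃ t, z t * g = h)
    (hinv : ∀ g, cl g⁻¹ = ρ (cl g)) (hρ : ∀ (t : T) s, ρ (t • s) = t⁻¹ • ρ s) (P : Set S)
    (hP : P ⊆ Set.range cl) (hPT : ∀ (t : T) s, s ∈ P → t • s ∈ P) :
    Nat.card {c : ConjClasses Q // IsReal c ∧ ∃ g, ConjClasses.mk (φ g) = c ∧ cl g ∈ P} *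
      Nat.card T = ∑ t : T, Nat.card {s // s ∈ P ∧ ρ s = t • s} := by
  classical
  have key := isConj_map_iff φ cl z hcl hz hφ hφz
  have : Nonempty G := ⟨1⟩
  have hsel : ∀ s ∈ P, cl (Function.invFun cl s) = s := fun s hs => Function.invFun_eq (hP hs)
  rw [← card_orbits_mul_card ρ hρ P ((Set.finite_range cl).subset hP) hPT
    (fun s => ConjClasses.mk (φ (Function.invFun cl s))) (fun s hs s' hs' => by
      rw [ConjClasses.mk_eq_mk_iff_isConj, key, hsel s hs, hsel s' hs'])]
  congr 1
  refine Nat.card_congr (Equiv.subtypeEquivRight fun c => ⟨?_, ?_⟩)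
  · rintro ⟨h1, g, rfl, hg⟩
    refine ⟨cl g, hg, ?_, ?_⟩
    · rw [ConjClasses.mk_eq_mk_iff_isConj, key, hsel _ hg]
      exact ⟨1, one_smul _ _⟩
    · rw [isReal_mk_iff, ← map_inv, key, hinv] at h1
      obtain ⟨t, ht⟩ := h1
      exact ⟨t, ht.symm⟩
  · rintro ⟨s, hs, rfl, t, ht⟩
    refine ⟨?_, _, rfl, by rwa [hsel s hs]⟩
    rw [isReal_mk_iff, ← map_inv, key, hinv, hsel s hs]
    exact ⟨t, ht.symm⟩

end Counting

/-! ### Sequences of monic polynomials -/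
section MonicSeq
variable {k : Type*} [Field k]

/-- Sequences of monic polynomials with nonzero constant term. -/
def MonicSeq (k : Type*) [Field k] : Type _ :=
  {f : ℕ → k[X] // ∀ i, (f i).Monic ∧ (f i).coeff 0 ≠ 0}

namespace MonicSeq

/-- The action of scalars by multiplication of roots. -/
noncomputable instance : MulAction kˣ (MonicSeq k) where
  smul c f := ⟨fun i => (f.1 i).scaleRoots c, fun i => ⟨(monic_scaleRoots_iff _).2 (f.2 i).1, by
    rw [coeff_scaleRoots]
    exact mul_ne_zero (f.2 i).2 (pow_ne_zero _ c.ne_zero)⟩⟩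
  one_smul f := Subtype.ext (funext fun i => scaleRoots_one _)
  mul_smul c d f := Subtype.ext (funext fun i => by
    change (f.1 i).scaleRoots ↑(c * d) = ((f.1 i).scaleRoots d).scaleRoots c
    rw [← scaleRoots_mul, mul_comm, Units.val_mul])

theorem smul_val (c : kˣ) (f : MonicSeq k) (i : ℕ) : (c • f).1 i = (f.1 i).scaleRoots c := rfl

/-- The sequence of reciprocal polynomials. -/
noncomputable def rev (f : MonicSeq k) : MonicSeq k :=
  ⟨fun i => reciprocal (f.1 i), fun i => ⟨monic_reciprocal (f.2 i).2, by
    rw [coeff_zero_reciprocal (f.2 i).1]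
    exact inv_ne_zero (f.2 i).2⟩⟩

theorem rev_rev (f : MonicSeq k) : f.rev.rev = f :=
  Subtype.ext (funext fun i => reciprocal_reciprocal (f.2 i).1 (f.2 i).2)

theorem rev_smul (c : kˣ) (f : MonicSeq k) : (c • f).rev = c⁻¹ • f.rev :=
  Subtype.ext (funext fun i => by
    change reciprocal ((f.1 i).scaleRoots c) = (reciprocal (f.1 i)).scaleRoots ↑c⁻¹
    rw [reciprocal_scaleRoots _ c.ne_zero, Units.val_inv_eq_inv_val])

/-- The sequence obtained by applying a homomorphism to the coefficients. -/
noncomputable def map {K : Type*} [Field K] (σ : k →+* K) (f : MonicSeq k) : MonicSeq K :=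
  ⟨fun i => (f.1 i).map σ, fun i => ⟨(f.2 i).1.map σ, by
    rw [coeff_map]
    exact (map_ne_zero σ).2 (f.2 i).2⟩⟩

theorem map_injective {K : Type*} [Field K] (σ : k →+* K) :
    Function.Injective (map σ : MonicSeq k → MonicSeq K) := fun _ _ h =>
  Subtype.ext (funext fun i =>
    Polynomial.map_injective σ σ.injective (congrFun (congrArg Subtype.val h) i))

theorem rev_map {K : Type*} [Field K] (σ : k →+* K) (f : MonicSeq k) :
    (f.map σ).rev = f.rev.map σ :=
  Subtype.ext (funext fun i => reciprocal_map σ (f.1 i))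

theorem map_smul {K : Type*} [Field K] (σ : k →+* K) (c : kˣ) (f : MonicSeq k) :
    (c • f).map σ = Units.map (σ : k →* K) c • f.map σ :=
  Subtype.ext (funext fun i => map_scaleRoots _ _ σ (by
    rw [(f.2 i).1.leadingCoeff, map_one]
    exact one_ne_zero))

theorem map_map {K L : Type*} [Field K] [Field L] (σ : k →+* K) (τ : K →+* L) (f : MonicSeq k) :
    (f.map σ).map τ = f.map (τ.comp σ) :=
  Subtype.ext (funext fun i => Polynomial.map_map σ τ (f.1 i))

/-- The sequences `f` of type `ν`, that is, with `deg f i` equal to the multiplicity of the part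
`i` in `ν`. This includes `i = 0`, where the multiplicity is `0` and the condition says that
`f 0 = 1`. -/
def ofType (k : Type*) [Field k] {n : ℕ} (ν : n.Partition) : Set (MonicSeq k) :=
  {f | ∀ i, (f.1 i).natDegree = ν.parts.count i}

theorem smul_mem_ofType {n : ℕ} {ν : n.Partition} {f : MonicSeq k} (c : kˣ) :
    c • f ∈ ofType k ν ↔ f ∈ ofType k ν :=
  forall_congr' fun i => by rw [smul_val, natDegree_scaleRoots]

theorem map_mem_ofType {K : Type*} [Field K] (σ : k →+* K) {n : ℕ} {ν : n.Partition}
    {f : MonicSeq k} : f.map σ ∈ ofType K ν ↔ f ∈ ofType k ν :=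
  forall_congr' fun i => by rw [map, natDegree_map]

end MonicSeq

open MonicSeq

/-- The class sequence of an invertible matrix. -/
noncomputable def classSeq {n : ℕ} (g : GL (Fin n) k) : MonicSeq k :=
  ⟨(exists_isClassSequence g.val).choose, fun i =>
    ⟨(exists_isClassSequence g.val).choose_spec.monic i,
      (exists_isClassSequence g.val).choose_spec.coeff_zero_ne_zero g.isUnit i⟩⟩

theorem isClassSequence_classSeq {n : ℕ} (g : GL (Fin n) k) :
    IsClassSequence g.val (classSeq g).1 := (exists_isClassSequence g.val).choose_spec

theorem classSeq_eq_of_isClassSequence {n : ℕ} {g : GL (Fin n) k} {f : MonicSeq k}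
    (h : IsClassSequence g.val f.1) : classSeq g = f :=
  Subtype.ext ((isClassSequence_classSeq g).unique h)

theorem classSeq_eq_iff {n : ℕ} {g h : GL (Fin n) k} :
    classSeq g = classSeq h ↔ ∃ x : GL (Fin n) k, x.val * g.val = h.val * x.val := by
  constructor
  · intro hgh
    have := isClassSequence_classSeq g
    rw [hgh] at this
    exact this.similar (isClassSequence_classSeq h)
  · rintro ⟨x, hx⟩
    exact (classSeq_eq_of_isClassSequence ((isClassSequence_classSeq g).of_similar x hx)).symm

theorem classSeq_inv {n : ℕ} (g : GL (Fin n) k) : classSeq g⁻¹ = (classSeq g).rev :=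
  classSeq_eq_of_isClassSequence (isClassSequence_classSeq g).inv

theorem classSeq_eq_smul {n : ℕ} {g h : GL (Fin n) k} (c : kˣ) (hg : h.val = (c : k) • g.val) :
    classSeq h = c • classSeq g := by
  apply classSeq_eq_of_isClassSequence
  rw [hg]
  exact (isClassSequence_classSeq g).smul c.ne_zero

theorem hasType_iff {n : ℕ} {g : GL (Fin n) k} {ν : n.Partition} :
    HasType g.val ν ↔ classSeq g ∈ ofType k ν := by
  constructor
  · rintro ⟨f, hf, hd⟩ i
    rw [(isClassSequence_classSeq g).unique hf]
    rcases Nat.eq_zero_or_pos i with rfl | hi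
    · rw [hf.zero, natDegree_one, eq_comm, Multiset.count_eq_zero]
      exact fun h => (ν.parts_pos h).ne rfl
    · exact hd i hi
  · exact fun h => ⟨_, isClassSequence_classSeq g, fun i _ => h i⟩

theorem sum_count_mul_eq (s : Multiset ℕ) (I : Finset ℕ) (hI : s.toFinset ⊆ I) :
    ∑ i ∈ I, i * s.count i = s.sum := by
  rw [Finset.sum_multiset_count_of_subset s I hI]
  exact Finset.sum_congr rfl fun i _ => by rw [smul_eq_mul, mul_comm]

theorem exists_classSeq_eq {n : ℕ} {ν : n.Partition} {f : MonicSeq k} (hf : f ∈ ofType k ν) :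
    ∃ g : GL (Fin n) k, classSeq g = f := by
  obtain ⟨m, hm, h1, h2⟩ := exists_divSeq_eq (fun i => (f.2 i).1) ν.parts.toFinset
    (fun h => (ν.parts_pos (Multiset.mem_toFinset.1 h)).ne rfl) (fun i hi => by
      refine eq_one_of_monic_natDegree_zero (f.2 i).1 ?_
      rw [hf i, Multiset.count_eq_zero]
      exact fun h => hi (Multiset.mem_toFinset.2 h))
  rw [Finset.sum_congr rfl fun i _ => by rw [hf i],
    sum_count_mul_eq ν.parts _ (Finset.Subset.refl _), ν.parts_sum] at h2
  obtain ⟨A, hA⟩ := hm.exists_hasElemDiv h2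
  have hA' : IsClassSequence A f.1 := isClassSequence_iff.2 ⟨m, hA, h1.symm⟩
  obtain ⟨g, rfl⟩ := hA'.isUnit fun i => (f.2 i).2
  exact ⟨g, classSeq_eq_of_isClassSequence hA'⟩

/-- Every class sequence has a type. -/
theorem exists_classSeq_mem_ofType {n : ℕ} (g : GL (Fin n) k) :
    ∃ ν : n.Partition, classSeq g ∈ ofType k ν := by
  classical
  obtain ⟨m, hm, h⟩ := isClassSequence_iff.1 (isClassSequence_classSeq g)
  let parts : Multiset ℕ := m.bind fun x => Multiset.replicate x.1.natDegree x.2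
  have hsum : parts.sum = n := by
    rw [← hm.degree_eq, Multiset.sum_bind]
    refine congrArg _ (Multiset.map_congr rfl fun x _ => ?_)
    rw [Multiset.sum_replicate, smul_eq_mul, mul_comm]
  refine ⟨⟨parts, fun {i} hi => ?_, hsum⟩, fun i => ?_⟩
  · obtain ⟨x, hx, hi⟩ := Multiset.mem_bind.1 hi
    rw [Multiset.eq_of_mem_replicate hi]
    exact (hm.1 x hx).2.2
  · rw [h, divSeq, natDegree_multiset_prod_of_monic _ fun p hp => by
      obtain ⟨x, hx, rfl⟩ := Multiset.mem_map.1 hp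
      exact (hm.1 x (Multiset.mem_of_mem_filter hx)).1]
    change _ = Multiset.count i parts
    rw [Multiset.count_bind, Multiset.map_map]
    have : ∀ m : Multiset (k[X] × ℕ),
        (Multiset.map (natDegree ∘ Prod.fst) (m.filter fun x => x.2 = i)).sum =
        (Multiset.map
          (fun x => Multiset.count i (Multiset.replicate x.1.natDegree x.2)) m).sum := by
      intro m
      induction m using Multiset.induction_on with
      | empty => simp
      | cons x m ih =>
        rw [Multiset.map_cons, Multiset.sum_cons, ← ih, Multiset.count_replicate]
        split_ifs with hx
        · rw [Multiset.filter_cons_of_pos (p := fun x : k[X] × ℕ => x.2 = i) m hx,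
            Multiset.map_cons, Multiset.sum_cons]
          rfl
        · rw [Multiset.filter_cons_of_neg (p := fun x : k[X] × ℕ => x.2 = i) m hx, zero_add]
    exact this m

theorem ofType_unique {n : ℕ} {ν ν' : n.Partition} {f : MonicSeq k} (h : f ∈ ofType k ν)
    (h' : f ∈ ofType k ν') : ν = ν' := by
  ext i
  rw [← h i, ← h' i]

end MonicSeq

open MonicSeq

/-! ### Real classes of the projective linear group -/

/-- The number of sequences `f` of type `ν` whose reciprocal is the multiple of `f` by `c`. -/
noncomputable def numSeq {k : Type*} [Field k] (c : kˣ) {n : ℕ} (ν : n.Partition) : ℕ :=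
  Nat.card {f : MonicSeq k // f ∈ ofType k ν ∧ f.rev = c • f}

theorem pglHasType_iff {F : Type*} [Field F] {n : ℕ} {ν : n.Partition} {c : ConjClasses (PGL F n)} :
    PGLHasType ν c ↔ ∃ g : GL (Fin n) F,
      ConjClasses.mk (Matrix.ProjGenLinGroup.mk g) = c ∧ classSeq g ∈ ofType F ν :=
  exists_congr fun _ => and_congr_right fun _ => hasType_iff

theorem classSeq_eq_iff_isConj {k : Type*} [Field k] {n : ℕ} (g h : GL (Fin n) k) :
    classSeq g = classSeq h ↔ IsConj g h := by
  rw [classSeq_eq_iff, isConj_iff]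
  refine exists_congr fun x => ?_
  rw [mul_inv_eq_iff_eq_mul, Units.ext_iff, Units.val_mul, Units.val_mul]

theorem classSeq_scalar_mul {k : Type*} [Field k] {n : ℕ} (c : kˣ) (g : GL (Fin n) k) :
    classSeq (Matrix.GeneralLinearGroup.scalar (Fin n) c * g) = c • classSeq g :=
  classSeq_eq_smul c (by
    rw [Units.val_mul]
    change Matrix.scalar (Fin n) (c : k) * g.val = _
    rw [Matrix.scalar_apply, ← Matrix.smul_eq_diagonal_mul])

theorem mk_PGL_eq_iff {k : Type*} [Field k] {n : ℕ} (g h : GL (Fin n) k) :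
    Matrix.ProjGenLinGroup.mk g = Matrix.ProjGenLinGroup.mk h ↔
      ∃ c : kˣ, Matrix.GeneralLinearGroup.scalar (Fin n) c * g = h := by
  rw [Matrix.ProjGenLinGroup.mk_eq_mk_iff]
  exact exists_congr fun c => by rw [Matrix.GeneralLinearGroup.scalar_commute c g]

theorem isConj_PGL_iff {k : Type*} [Field k] {n : ℕ} (g h : GL (Fin n) k) :
    IsConj (Matrix.ProjGenLinGroup.mk g) (Matrix.ProjGenLinGroup.mk h) ↔
      ∃ c : kˣ, c • classSeq g = classSeq h :=
  isConj_map_iff _ _ _ classSeq_eq_iff_isConj classSeq_scalar_mul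
    Matrix.ProjGenLinGroup.mk_surjective mk_PGL_eq_iff g h

theorem pgl_mul_card {F : Type*} [Field F] [Finite F] [Fintype Fˣ] {n : ℕ} (ν : n.Partition) :
    pgl F ν * Nat.card Fˣ = ∑ c : Fˣ, numSeq c ν := by
  rw [pgl]
  simp only [pglHasType_iff]
  exact card_isReal_mul_card (Matrix.ProjGenLinGroup.mk : GL (Fin n) F →* PGL F n) classSeq
    (Matrix.GeneralLinearGroup.scalar (Fin n)) MonicSeq.rev classSeq_eq_iff_isConj
    classSeq_scalar_mul Matrix.ProjGenLinGroup.mk_surjective mk_PGL_eq_iff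
    classSeq_inv rev_smul (ofType F ν) (fun f hf => exists_classSeq_eq hf)
    fun t f hf => (smul_mem_ofType t).2 hf

/-! ### The quadratic extension of a finite field -/
section Quadratic
variable {F K : Type*} [Field F] [Fintype F] [Field K] [Algebra F K]

/-- The involution `a ↦ a ^ q` of the field with `q ^ 2` elements. It is made an instance only
where the extension is fixed; other statements on the unitary group take a `StarRing` structure with
`star a = a ^ q` as a hypothesis. -/
@[reducible]
def frobeniusStarRing [Fintype K] (hK : Fintype.card K = Fintype.card F ^ 2) : StarRing K where
  star a := a ^ Fintype.card F
  star_involutive a := by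
    change (a ^ Fintype.card F) ^ Fintype.card F = a
    rw [← pow_mul, ← sq, ← hK, FiniteField.pow_card]
  star_mul a b := by
    change (a * b) ^ Fintype.card F = b ^ Fintype.card F * a ^ Fintype.card F
    rw [mul_pow, mul_comm]
  star_add a b := map_add (FiniteField.frobeniusAlgHom F K) a b

theorem mem_range_algebraMap_of_pow_eq [Finite K] {a : K} (ha : a ^ Fintype.card F = a) :
    a ∈ Set.range (algebraMap F K) := by
  rw [IsGalois.mem_range_algebraMap_iff_fixed]
  intro f
  obtain ⟨i, rfl⟩ := (FiniteField.bijective_frobeniusAlgEquivOfAlgebraic_pow F K).2 f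
  have : ∀ i : ℕ, (FiniteField.frobeniusAlgEquivOfAlgebraic F K ^ i) a = a := fun i => by
    induction i with
    | zero => rfl
    | succ i ih =>
      rw [pow_succ, AlgEquiv.mul_apply, FiniteField.coe_frobeniusAlgEquivOfAlgebraic]
      dsimp only
      rw [ha, ih]
  exact this i

theorem algebraMap_norm_eq [Fintype K] (hK : Fintype.card K = Fintype.card F ^ 2) (a : K) :
    algebraMap F K (Algebra.norm F a) = a * a ^ Fintype.card F := by
  have hq : 1 < Fintype.card F := Fintype.one_lt_card
  rw [FiniteField.algebraMap_norm_eq_pow, ← pow_succ', Nat.card_eq_fintype_card,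
    Nat.card_eq_fintype_card, hK]
  congr 1
  obtain ⟨m, hm⟩ := Nat.exists_eq_add_of_lt hq
  rw [hm]
  refine Nat.div_eq_of_eq_mul_left (by omega) ?_
  rw [show 1 + m + 1 - 1 = m + 1 by omega]
  refine Nat.sub_eq_of_eq_add ?_
  ring

theorem exists_pow_card_ne [Fintype K] (hK : Fintype.card K = Fintype.card F ^ 2) :
    ∃ l : K, l ^ Fintype.card F ≠ l := by
  by_contra! h
  have h1 : Function.Surjective (algebraMap F K) := fun a => mem_range_algebraMap_of_pow_eq (h a)
  have h2 := Fintype.card_le_of_surjective _ h1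
  have hq : 1 < Fintype.card F := Fintype.one_lt_card
  rw [hK] at h2
  nlinarith

end Quadratic

/-! ### Real classes of the projective unitary group -/
section ProjectiveUnitary

/-- The units `c` with `c * star c = 1`. -/
def normOne (K : Type*) [Field K] [StarRing K] : Subgroup Kˣ :=
  (MonoidHom.id Kˣ * (starMulAut : Kˣ ≃* Kˣ).toMonoidHom).ker

theorem mem_normOne {K : Type*} [Field K] [StarRing K] {c : Kˣ} :
    c ∈ normOne K ↔ (c : K) * star (c : K) = 1 := by
  rw [normOne, MonoidHom.mem_ker, Units.ext_iff]
  rfl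

theorem mem_U_iff {F K : Type*} [Field F] [Fintype F] [Field K] [Algebra F K] [StarRing K]
    (hs : ∀ a : K, star a = a ^ Fintype.card F) {n : ℕ} {g : GL (Fin n) K} :
    g ∈ U F K n ↔ g.val.conjTranspose * g.val = 1 := by
  have h : g.val.conjTranspose = (g.val.map fun a => a ^ Fintype.card F).transpose := by
    ext i j
    exact hs _
  rw [h]
  change (Units.mk _ _ _ _)⁻¹ = g ↔ _
  rw [inv_eq_iff_mul_eq_one, Units.ext_iff]
  rfl

variable {F K : Type*} [Field F] [Fintype F] [Field K] [StarRing K]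

theorem classSeq_conjTranspose {n : ℕ} {g h : GL (Fin n) K} (hgh : h.val = g.val.conjTranspose) :
    classSeq h = (classSeq g).map (starRingEnd K) := by
  apply classSeq_eq_of_isClassSequence
  rw [hgh]
  exact (isClassSequence_classSeq g).map_transpose starRingAut

theorem rev_classSeq_of_unitary {n : ℕ} {g : GL (Fin n) K}
    (hg : g.val.conjTranspose * g.val = 1) :
    (classSeq g).rev = (classSeq g).map (starRingEnd K) := by
  rw [← classSeq_inv]
  exact classSeq_conjTranspose (Units.inv_eq_of_mul_eq_one_left hg)

theorem exists_unitary_classSeq_eq [Finite K] {l : K} (hl : star l ≠ l) {n : ℕ} {ν : n.Partition}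
    {f : MonicSeq K} (hf : f ∈ ofType K ν) (hf' : f.rev = f.map (starRingEnd K)) :
    ∃ g : GL (Fin n) K, g.val.conjTranspose * g.val = 1 ∧ classSeq g = f := by
  obtain ⟨g, rfl⟩ := exists_classSeq_eq hf
  have h1 : classSeq (star g)⁻¹ = classSeq g := by
    rw [classSeq_inv, classSeq_conjTranspose (g := g) rfl, ← hf', rev_rev]
  obtain ⟨x, hx⟩ := classSeq_eq_iff.1 h1.symm
  have h2 : g.val.conjTranspose * x.val * g.val = x.val := by
    rw [mul_assoc, hx, ← mul_assoc]
    have : g.val.conjTranspose * ((star g)⁻¹).val = 1 := Units.mul_inv (star g)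
    rw [this, one_mul]
  obtain ⟨y, hy⟩ := exists_similar_unitary hl h2
  exact ⟨_, hy, ((classSeq_eq_iff_isConj _ _).2 (isConj_iff.2 ⟨y, rfl⟩)).symm⟩

/-- A matrix commuting with all unitary matrices is scalar: it commutes with the diagonal matrices
with entries of norm one, and with the permutation matrices. -/
theorem eq_scalar_of_commute_unitary {l : K} (hl : star l ≠ l) {n : ℕ}
    {w : Matrix (Fin n) (Fin n) K}
    (hw : ∀ g : Matrix (Fin n) (Fin n) K, g.conjTranspose * g = 1 → g * w = w * g) :
    ∃ c : K, w = c • (1 : Matrix (Fin n) (Fin n) K) := by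
  have hl0 : l ≠ 0 := fun h => hl (by rw [h, star_zero])
  have hsl : star l ≠ 0 := star_ne_zero.2 hl0
  let ζ := l / star l
  have hζ1 : star ζ * ζ = 1 := by
    simp only [ζ, star_div₀, star_star]
    field_simp
  have hζ : ζ ≠ 1 := fun h => hl ((div_eq_one_iff_eq hsl).1 h).symm
  have hdiag : ∀ i j, i ≠ j → w i j = 0 := by
    intro i j hij
    have h1 := hw (Matrix.diagonal (Function.update 1 i ζ)) (by
      rw [Matrix.diagonal_conjTranspose, Matrix.diagonal_mul_diagonal, ← Matrix.diagonal_one]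
      congr 1
      ext a
      by_cases ha : a = i
      · subst ha; simp [hζ1]
      · simp [ha])
    have h2 := congrFun (congrFun h1 i) j
    rw [Matrix.diagonal_mul, Matrix.mul_diagonal, Function.update_self,
      Function.update_of_ne hij.symm, Pi.one_apply, mul_one] at h2
    by_contra h0
    exact hζ (mul_right_cancel₀ h0 (by rw [h2, one_mul]))
  have hconst : ∀ i j, w i i = w j j := by
    intro i j
    have h1 := hw ((Equiv.swap i j).permMatrix K) (by
      rw [Matrix.conjTranspose_permMatrix, ← Matrix.permMatrix_mul, mul_inv_cancel,
        Matrix.permMatrix_one])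
    have h2 := congrFun (congrFun h1 i) j
    rw [PEquiv.toMatrix_toPEquiv_mul, PEquiv.mul_toMatrix_toPEquiv] at h2
    simpa using h2.symm
  rcases Nat.eq_zero_or_pos n with rfl | hn
  · exact ⟨1, Subsingleton.elim _ _⟩
  · refine ⟨w ⟨0, hn⟩ ⟨0, hn⟩, ?_⟩
    ext i j
    by_cases hij : i = j
    · subst hij
      simp [hconst i ⟨0, hn⟩]
    · simp [hdiag i j hij, hij]

variable [Algebra F K]

theorem isConj_U_iff [Finite K] (hs : ∀ a : K, star a = a ^ Fintype.card F) {l : K}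
    (hl : star l ≠ l) {n : ℕ} (g h : U F K n) : classSeq g.val = classSeq h.val ↔ IsConj g h := by
  rw [classSeq_eq_iff_isConj]
  constructor
  · intro hgh
    obtain ⟨x, hx⟩ := isConj_iff.1 hgh
    rw [mul_inv_eq_iff_eq_mul, Units.ext_iff, Units.val_mul, Units.val_mul] at hx
    obtain ⟨u, hu, hug⟩ := exists_unitary_similar hl ((mem_U_iff hs).1 g.2)
      ((mem_U_iff hs).1 h.2) hx
    refine isConj_iff.2 ⟨⟨u, (mem_U_iff hs).2 hu⟩, ?_⟩
    rw [mul_inv_eq_iff_eq_mul]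
    exact Subtype.ext (Units.ext hug)
  · exact fun h => (U F K n).subtype.map_isConj h

theorem scalar_mem_U (hs : ∀ a : K, star a = a ^ Fintype.card F) {n : ℕ} {c : Kˣ}
    (hc : c ∈ normOne K) : Matrix.GeneralLinearGroup.scalar (Fin n) c ∈ U F K n := by
  rw [mem_U_iff hs, Matrix.GeneralLinearGroup.coe_scalar, Matrix.scalar_apply,
    Matrix.diagonal_conjTranspose, Matrix.diagonal_mul_diagonal, ← Matrix.diagonal_one]
  congr 1
  ext i
  rw [mul_comm]
  exact mem_normOne.1 hc

theorem mk_PGU_eq_iff (hs : ∀ a : K, star a = a ^ Fintype.card F) {l : K} (hl : star l ≠ l) {n : ℕ}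
    (g h : U F K n) : (QuotientGroup.mk g : PGU F K n) = QuotientGroup.mk h ↔
      ∃ t : normOne K, (⟨_, scalar_mem_U hs t.2⟩ : U F K n) * g = h := by
  rw [QuotientGroup.eq]
  constructor
  · intro hc
    rcases Nat.eq_zero_or_pos n with rfl | hn
    · exact ⟨1, Subtype.ext (Units.ext (Subsingleton.elim _ _))⟩
    obtain ⟨c, hw⟩ := eq_scalar_of_commute_unitary hl (w := (g⁻¹ * h).val.val) (by
      intro m hm
      let m' : GL (Fin n) K := ⟨m, m.conjTranspose, mul_eq_one_comm.1 hm, hm⟩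
      have := Subgroup.mem_center_iff.1 hc ⟨m', (mem_U_iff hs).2 hm⟩
      exact congrArg (fun x : U F K n => x.val.val) this)
    have h1 : c * star c = 1 := by
      have h2 := (mem_U_iff hs).1 (g⁻¹ * h).2
      rw [hw] at h2
      have h3 := congrFun (congrFun h2 ⟨0, hn⟩) ⟨0, hn⟩
      simpa [mul_comm] using h3
    let t : Kˣ := ⟨c, star c, h1, by rw [mul_comm, h1]⟩
    refine ⟨⟨t, mem_normOne.2 h1⟩, ?_⟩
    have h2 : h = g * (g⁻¹ * h) := by group
    refine Subtype.ext (Units.ext ?_)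
    rw [h2]
    change Matrix.scalar (Fin n) c * g.val.val = g.val.val * (g⁻¹ * h).val.val
    rw [hw, Matrix.scalar_apply, ← Matrix.smul_eq_diagonal_mul, mul_smul_comm, mul_one]
  · rintro ⟨t, rfl⟩
    rw [Subgroup.mem_center_iff]
    have hc : ∀ x : U F K n, (⟨_, scalar_mem_U hs t.2⟩ : U F K n) * x =
        x * ⟨_, scalar_mem_U hs t.2⟩ := fun x =>
      Subtype.ext (Matrix.GeneralLinearGroup.scalar_commute _ _)
    intro x
    rw [hc, inv_mul_cancel_left, hc]

theorem isConj_PGU_iff [Finite K] (hs : ∀ a : K, star a = a ^ Fintype.card F) {l : K}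
    (hl : star l ≠ l) {n : ℕ} (g h : U F K n) :
    IsConj (QuotientGroup.mk g : PGU F K n) (QuotientGroup.mk h) ↔
      ∃ t : normOne K, t • classSeq g.val = classSeq h.val := by
  let φ : U F K n →* PGU F K n := QuotientGroup.mk' (Subgroup.center (U F K n))
  let z : normOne K → U F K n := fun t => ⟨_, scalar_mem_U hs t.2⟩
  have hφ : Function.Surjective φ := QuotientGroup.mk'_surjective _
  have hφz : ∀ g h, φ g = φ h ↔ ∃ t, z t * g = h := mk_PGU_eq_iff hs hl
  have hz : ∀ (t : normOne K) (g : U F K n),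
      classSeq (z t * g).val = t • classSeq g.val := fun t g => classSeq_scalar_mul t.1 g.val
  exact isConj_map_iff φ (fun g : U F K n => classSeq g.val) z (isConj_U_iff hs hl) hz hφ hφz g h

/-- The class sequences of unitary matrices of type `ν`. -/
def unitaryOfType (K : Type*) [Field K] [StarRing K] {n : ℕ} (ν : n.Partition) :
    Set (MonicSeq K) :=
  {f | f ∈ ofType K ν ∧ f.rev = f.map (starRingEnd K)}

theorem smul_mem_unitaryOfType {n : ℕ} {ν : n.Partition} (t : normOne K) {f : MonicSeq K}
    (hf : f ∈ unitaryOfType K ν) : t.1 • f ∈ unitaryOfType K ν := by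
  refine ⟨(smul_mem_ofType _).2 hf.1, ?_⟩
  rw [rev_smul, MonicSeq.map_smul, hf.2]
  congr 1
  rw [inv_eq_iff_mul_eq_one]
  exact Units.ext (mem_normOne.1 t.2)

theorem pgu_mul_card [Finite K] [Fintype (normOne K)]
    (hs : ∀ a : K, star a = a ^ Fintype.card F) {l : K} (hl : star l ≠ l) {n : ℕ} (ν : n.Partition) :
    pgu F K ν * Nat.card (normOne K) =
      ∑ t : normOne K, Nat.card {f : MonicSeq K // f ∈ unitaryOfType K ν ∧ f.rev = t.1 • f} := by
  have htype : ∀ c : ConjClasses (PGU F K n), PGUHasType ν c ↔ ∃ g : U F K n,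
      ConjClasses.mk (QuotientGroup.mk' (Subgroup.center (U F K n)) g) = c ∧
        classSeq g.val ∈ unitaryOfType K ν := fun c =>
    exists_congr fun g => and_congr_right fun _ => by
      rw [hasType_iff]
      exact ⟨fun h => ⟨h, rev_classSeq_of_unitary ((mem_U_iff hs).1 g.2)⟩, fun h => h.1⟩
  rw [pgu, Nat.card_congr (Equiv.subtypeEquivRight fun c => and_congr_right fun _ => htype c)]
  let φ : U F K n →* PGU F K n := QuotientGroup.mk' (Subgroup.center (U F K n))
  let z : normOne K → U F K n := fun t => ⟨_, scalar_mem_U hs t.2⟩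
  have hφ : Function.Surjective φ := QuotientGroup.mk'_surjective _
  have hφz : ∀ g h, φ g = φ h ↔ ∃ t, z t * g = h := mk_PGU_eq_iff hs hl
  have hz : ∀ (t : normOne K) (g : U F K n),
      classSeq (z t * g).val = t • classSeq g.val := fun t g => classSeq_scalar_mul t.1 g.val
  have hP : unitaryOfType K ν ⊆ Set.range fun g : U F K n => classSeq g.val := fun f hf => by
    obtain ⟨g, hg, rfl⟩ := exists_unitary_classSeq_eq hl hf.1 hf.2
    exact ⟨⟨g, (mem_U_iff hs).2 hg⟩, rfl⟩
  have hinv : ∀ g : U F K n, classSeq (g⁻¹).val = (classSeq g.val).rev := fun g =>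
    classSeq_inv g.val
  have hρ : ∀ (t : normOne K) (f : MonicSeq K), (t • f).rev = t⁻¹ • f.rev := fun t f =>
    rev_smul t.1 f
  exact card_isReal_mul_card φ (fun g : U F K n => classSeq g.val) z MonicSeq.rev
    (isConj_U_iff hs hl) hz hφ hφz hinv hρ (unitaryOfType K ν) hP
    fun t f hf => smul_mem_unitaryOfType t hf

/-- Multiplication by `λ⁻¹` matches the sequences over the small field with `f.rev = c⁻¹ • f`, where
`c = λ * star λ`, with the unitary sequences with `f.rev = (λ / star λ) • f`. -/
theorem card_unitaryOfType_eq [Finite K] (hs : ∀ a : K, star a = a ^ Fintype.card F) {n : ℕ}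
    (ν : n.Partition) (a t : Kˣ) (c : Fˣ)
    (hc : Units.map (algebraMap F K : F →* K) c = a * star a) (ht : t = a / star a) :
    Nat.card {f : MonicSeq K // f ∈ unitaryOfType K ν ∧ f.rev = t • f} = numSeq c⁻¹ ν := by
  have hstar : ∀ a : Kˣ, Units.map (starRingEnd K : K →* K) a = star a := fun a => rfl
  have hfix : ∀ g : MonicSeq F, (g.map (algebraMap F K)).map (starRingEnd K) =
      g.map (algebraMap F K) := fun g => by
    rw [MonicSeq.map_map]
    congr 1
    ext x
    change star (algebraMap F K x) = algebraMap F K x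
    rw [hs, ← map_pow, FiniteField.pow_card]
  have hdesc : ∀ f : MonicSeq K, f.map (starRingEnd K) = f →
      ∃ g : MonicSeq F, g.map (algebraMap F K) = f := fun f hf => by
    have h1 : ∀ i, ∃ p : F[X], p.map (algebraMap F K) = f.1 i := fun i => by
      have : f.1 i ∈ Polynomial.lifts (algebraMap F K) := by
        rw [Polynomial.lifts_iff_coeff_lifts]
        intro j
        apply mem_range_algebraMap_of_pow_eq
        rw [← hs]
        have := congrArg (fun f : MonicSeq K => (f.1 i).coeff j) hf
        change ((f.1 i).map (starRingEnd K)).coeff j = _ at this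
        rwa [coeff_map] at this
      exact (Polynomial.mem_lifts _).1 this
    choose p hp using h1
    refine ⟨⟨p, fun i => ⟨?_, ?_⟩⟩, Subtype.ext (funext hp)⟩
    · have := (f.2 i).1
      rw [← hp] at this
      exact monic_of_injective (algebraMap F K).injective this
    · have := (f.2 i).2
      rw [← hp, coeff_map] at this
      exact (_root_.map_ne_zero _).1 this
  have hcK : ∀ g : MonicSeq F, g.rev = c⁻¹ • g ↔ (g.map (algebraMap F K)).rev =
      (a * star a)⁻¹ • g.map (algebraMap F K) := fun g => by
    rw [rev_map, ← hc, ← _root_.map_inv, ← MonicSeq.map_smul,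
      (MonicSeq.map_injective (algebraMap F K)).eq_iff]
  have hmem : ∀ g : {g : MonicSeq F // g ∈ ofType F ν ∧ g.rev = c⁻¹ • g},
      a⁻¹ • g.1.map (algebraMap F K) ∈ unitaryOfType K ν ∧
        (a⁻¹ • g.1.map (algebraMap F K)).rev = t • a⁻¹ • g.1.map (algebraMap F K) := by
    rintro ⟨g, hg, hg'⟩
    rw [hcK] at hg'
    refine ⟨⟨(smul_mem_ofType _).2 ((map_mem_ofType _).2 hg), ?_⟩, ?_⟩
    · rw [rev_smul, MonicSeq.map_smul, hfix, hg', smul_smul, hstar]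
      congr 1
      rw [star_inv, mul_inv, inv_inv, mul_inv_cancel_left]
    · rw [rev_smul, hg', smul_smul, smul_smul, ht]
      congr 1
      rw [mul_inv, inv_inv, mul_inv_cancel_left, div_mul_eq_mul_div, mul_inv_cancel, one_div]
  refine (Nat.card_congr (Equiv.ofBijective (fun g => ⟨_, hmem g⟩) ⟨?_, ?_⟩)).symm
  · intro g g' h
    have := congrArg Subtype.val h
    exact Subtype.ext (MonicSeq.map_injective _ (smul_left_cancel _ this))
  · rintro ⟨f, ⟨hf, hf1⟩, hf2⟩
    obtain ⟨g, hg⟩ := hdesc (a • f) (by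
      rw [MonicSeq.map_smul, ← hf1, hf2, smul_smul, hstar, ht]
      congr 1
      rw [mul_div_cancel])
    refine ⟨⟨g, (map_mem_ofType (algebraMap F K)).1 (by rw [hg]; exact (smul_mem_ofType a).2 hf),
      ?_⟩, Subtype.ext ?_⟩
    · rw [hcK, hg, rev_smul, hf2, smul_smul, smul_smul, ht]
      congr 1
      rw [mul_inv, div_eq_mul_inv, mul_assoc, mul_comm a]
    · change a⁻¹ • g.map (algebraMap F K) = f
      rw [hg, inv_smul_smul]

end ProjectiveUnitary

/-! ### Comparison of the linear and the unitary group -/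

theorem card_mul_sum_comp {G H : Type*} [Group G] [Group H] [Fintype G] [Fintype H] (f : G →* H)
    (hf : Function.Surjective f) (u : H → ℕ) :
    Nat.card H * ∑ g, u (f g) = Nat.card G * ∑ h, u h := by
  classical
  have h1 : ∀ u : H → ℕ, ∑ g, u (f g) = (Finset.univ.filter fun g => f g = 1).card * ∑ h, u h := by
    intro u
    rw [← Finset.sum_fiberwise Finset.univ f, Finset.mul_sum]
    refine Finset.sum_congr rfl fun h _ => ?_
    rw [Finset.sum_congr rfl fun g hg => by rw [(Finset.mem_filter.1 hg).2], Finset.sum_const,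
      smul_eq_mul, MonoidHom.card_fiber_eq_of_mem_range f (hf h) (hf 1)]
  have h2 := h1 fun _ => 1
  simp only [Finset.sum_const, Finset.card_univ, smul_eq_mul, mul_one] at h2
  rw [h1, Nat.card_eq_fintype_card, Nat.card_eq_fintype_card, h2]
  ring

/-- Both numbers are the average over `λ` in the units of the quadratic extension of the number of
sequences `f` with `f.rev = (λ ^ (q + 1))⁻¹ • f`. -/
theorem pgl_eq_pgu {F K : Type*} [Field F] [Fintype F] [Field K] [Fintype K] [Algebra F K]
    (hK : Fintype.card K = Fintype.card F ^ 2) {n : ℕ} (ν : n.Partition) :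
    pgl F ν = pgu F K ν := by
  classical
  let : StarRing K := frobeniusStarRing hK
  have hs : ∀ a : K, star a = a ^ Fintype.card F := fun _ => rfl
  obtain ⟨l, hl⟩ : ∃ l : K, star l ≠ l := exists_pow_card_ne hK
  let h : normOne K → ℕ := fun t =>
    Nat.card {f : MonicSeq K // f ∈ unitaryOfType K ν ∧ f.rev = t.1 • f}
  have hU : pgu F K ν * Nat.card (normOne K) = ∑ t, h t := pgu_mul_card hs hl ν
  let D : Kˣ →* normOne K :=
    (MonoidHom.id Kˣ / (starMulAut : Kˣ ≃* Kˣ).toMonoidHom).codRestrict (normOne K) fun a => by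
      rw [normOne, MonoidHom.mem_ker]
      change a / star a * star (a / star a) = 1
      rw [star_div, star_star, div_mul_div_cancel, div_self']
  have hD : Function.Surjective D := by
    rintro ⟨t, ht⟩
    obtain ⟨b, ⟨v, rfl⟩, hb⟩ := exists_isUnit_eq_star_mul (isUnit_sub_star hl) (mem_normOne.1 ht)
    refine ⟨v, Subtype.ext ?_⟩
    change v / star v = t
    rw [div_eq_iff_eq_mul, mul_comm]
    exact Units.ext hb
  have hDN : ∀ a, h (D a) = numSeq (Units.map (Algebra.norm F : K →* F) a)⁻¹ ν := fun a =>
    card_unitaryOfType_eq hs ν a _ _ (Units.ext (algebraMap_norm_eq hK a)) rfl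
  have h1 := card_mul_sum_comp D hD h
  have h2 := card_mul_sum_comp (Units.map (Algebra.norm F : K →* F))
    (FiniteField.unitsMap_norm_surjective F K) fun c => numSeq c⁻¹ ν
  have h3 : ∑ c : Fˣ, numSeq c⁻¹ ν = pgl F ν * Nat.card Fˣ := by
    rw [pgl_mul_card]
    exact Equiv.sum_comp (Equiv.inv Fˣ) fun c => numSeq c ν
  rw [← hU] at h1
  simp only [hDN] at h1
  rw [h3] at h2
  have hT : 0 < Nat.card (normOne K) := Nat.card_pos
  have hF : 0 < Nat.card Fˣ := Nat.card_pos
  have hK' : 0 < Nat.card Kˣ := Nat.card_pos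
  have h4 : ∑ a : Kˣ, numSeq (Units.map (Algebra.norm F : K →* F) a)⁻¹ ν =
      Nat.card Kˣ * pgu F K ν :=
    Nat.eq_of_mul_eq_mul_left hT (by rw [h1]; ring)
  have h5 : ∑ a : Kˣ, numSeq (Units.map (Algebra.norm F : K →* F) a)⁻¹ ν =
      Nat.card Kˣ * pgl F ν :=
    Nat.eq_of_mul_eq_mul_left hF (by rw [h2]; ring)
  exact Nat.eq_of_mul_eq_mul_left hK' (h5.symm.trans h4)

/-! ### Evaluation of the number of real classes -/
section Evaluation
variable {F : Type*} [Field F]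

theorem rev_eq_smul_iff {c : Fˣ} {f : MonicSeq F} :
    f.rev = c • f ↔ ∀ i, reciprocal (f.1 i) = (f.1 i).scaleRoots c :=
  ⟨fun h i => congrFun (congrArg Subtype.val h) i, fun h => Subtype.ext (funext h)⟩

theorem rev_eq_one_smul_iff {f : MonicSeq F} :
    f.rev = (1 : Fˣ) • f ↔ ∀ i, reciprocal (f.1 i) = f.1 i := by
  rw [rev_eq_smul_iff]
  exact forall_congr' fun i => by rw [Units.val_one, scaleRoots_one]

theorem numSeq_one {n : ℕ} (ν : n.Partition) :
    numSeq (1 : Fˣ) ν = ∏ i ∈ ν.parts.toFinset, r F (ν.parts.count i) := by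
  classical
  rw [← Finset.prod_coe_sort]
  simp only [r]
  rw [← Nat.card_pi, numSeq]
  have h1 : ∀ (f : MonicSeq F), f ∈ ofType F ν → ∀ i ∉ ν.parts.toFinset, f.1 i = 1 :=
    fun f hf i hi => eq_one_of_monic_natDegree_zero (f.2 i).1 (by
      rw [hf i, Multiset.count_eq_zero]
      exact fun h => hi (Multiset.mem_toFinset.2 h))
  refine Nat.card_congr
    { toFun := fun f i => ⟨f.1.1 i, (f.1.2 i).1, (f.1.2 i).2, f.2.1 i, ?_⟩
      invFun := fun g => ⟨⟨fun i => if h : i ∈ ν.parts.toFinset then (g ⟨i, h⟩).1 else 1, ?_⟩,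
        ?_, ?_⟩
      left_inv := ?_
      right_inv := ?_ }
  · exact rev_eq_one_smul_iff.1 f.2.2 i
  · intro i
    dsimp only
    split_ifs with h
    · exact ⟨(g ⟨i, h⟩).2.1, (g ⟨i, h⟩).2.2.1⟩
    · exact ⟨monic_one, by rw [coeff_one_zero]; exact one_ne_zero⟩
  · intro i
    dsimp only
    split_ifs with h
    · exact (g ⟨i, h⟩).2.2.2.1
    · rw [natDegree_one, eq_comm, Multiset.count_eq_zero]
      exact fun h' => h (Multiset.mem_toFinset.2 h')
  · refine rev_eq_one_smul_iff.2 fun i => ?_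
    dsimp only
    split_ifs with h
    · exact (g ⟨i, h⟩).2.2.2.2
    · exact map_one (reciprocalHom F)
  · rintro ⟨f, hf, hf'⟩
    refine Subtype.ext (Subtype.ext (funext fun i => ?_))
    dsimp only
    split_ifs with h
    · rfl
    · exact (h1 f hf i h).symm
  · intro g
    funext i
    refine Subtype.ext ?_
    simp

/-- The sequences with `f.rev = f` are the multiples by `a` of those with `f.rev = a ^ 2 • f`. -/
theorem numSeq_sq (a : Fˣ) {n : ℕ} (ν : n.Partition) : numSeq (a ^ 2) ν = numSeq (1 : Fˣ) ν := by
  refine Nat.card_congr ((MulAction.toPerm a : Equiv.Perm (MonicSeq F)).subtypeEquiv fun f => ?_)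
  rw [MulAction.toPerm_apply, smul_mem_ofType, rev_smul, one_smul, inv_smul_eq_iff, smul_smul, sq]

/-- The polynomial with the coefficients `c ^ (d / 2 - k) * a k`, if `f` has degree `d` and the
coefficients `a k`. The truncated subtraction leaves the upper half of the coefficients unchanged.
For `d` even this turns the self-reciprocal polynomials into the polynomials whose reciprocal
is obtained by multiplying their roots by `c⁻¹`. -/
noncomputable def twist (c : F) (f : F[X]) : F[X] :=
  ∑ k ∈ Finset.range (f.natDegree + 1), monomial k (f.coeff k * c ^ (f.natDegree / 2 - k))

theorem coeff_twist (c : F) (f : F[X]) (k : ℕ) :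
    (twist c f).coeff k = f.coeff k * c ^ (f.natDegree / 2 - k) := by
  rw [twist, finsetSum_coeff]
  simp only [coeff_monomial]
  rw [Finset.sum_ite_eq']
  split_ifs with h
  · rfl
  · rw [coeff_eq_zero_of_natDegree_lt (by simpa [Nat.lt_succ_iff] using h), zero_mul]

theorem monic_natDegree_twist (c : F) {f : F[X]} (hf : f.Monic) :
    (twist c f).Monic ∧ (twist c f).natDegree = f.natDegree := by
  have h1 : (twist c f).coeff f.natDegree = 1 := by
    rw [coeff_twist, Nat.sub_eq_zero_of_le (Nat.div_le_self _ _), pow_zero, mul_one,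
      coeff_natDegree, hf.leadingCoeff]
  have h2 : (twist c f).natDegree ≤ f.natDegree := by
    rw [natDegree_le_iff_coeff_eq_zero]
    intro k hk
    rw [coeff_twist, coeff_eq_zero_of_natDegree_lt hk, zero_mul]
  exact ⟨monic_of_natDegree_le_of_coeff_eq_one _ h2 h1,
    le_antisymm h2 (le_natDegree_of_ne_zero (by rw [h1]; exact one_ne_zero))⟩

theorem twist_twist {c c' : F} (hc : c * c' = 1) {f : F[X]} (hf : f.Monic) :
    twist c (twist c' f) = f := by
  ext k
  rw [coeff_twist, coeff_twist, (monic_natDegree_twist c' hf).2, mul_assoc, ← mul_pow, mul_comm c',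
    hc, one_pow, mul_one]

theorem reciprocal_twist_iff {c : F} (hc : c ≠ 0) {f : F[X]} (hf : f.Monic) (h0 : f.coeff 0 ≠ 0)
    (hd : Even f.natDegree) :
    reciprocal (twist c f) = (twist c f).scaleRoots c⁻¹ ↔ reciprocal f = f := by
  obtain ⟨h1, h2⟩ := monic_natDegree_twist c hf
  have h3 : (twist c f).coeff 0 ≠ 0 := by
    rw [coeff_twist]
    exact mul_ne_zero h0 (pow_ne_zero _ hc)
  rw [ext_iff_natDegree_le (n := f.natDegree) (by rw [natDegree_reciprocal h3, h2])
    (by rw [natDegree_scaleRoots, h2]), ext_iff_natDegree_le (n := f.natDegree)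
    (by rw [natDegree_reciprocal h0]) le_rfl]
  refine forall₂_congr fun k hk => ?_
  obtain ⟨e, he⟩ := hd
  rw [coeff_reciprocal _ (by rwa [h2]), coeff_reciprocal _ hk, coeff_scaleRoots, coeff_twist,
    coeff_twist, coeff_twist, h2, inv_pow]
  have hexp : c ^ (f.natDegree / 2 - (f.natDegree - k)) * c ^ (f.natDegree - k) =
      c ^ (f.natDegree / 2 - 0) * c ^ (f.natDegree / 2 - k) := by
    rw [← pow_add, ← pow_add]
    congr 1
    omega
  have hp : ∀ i, c ^ i ≠ 0 := fun i => pow_ne_zero i hc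
  rw [← div_eq_mul_inv, eq_div_iff (hp _), mul_inv]
  have : (f.coeff 0)⁻¹ * (c ^ (f.natDegree / 2 - 0))⁻¹ *
      (f.coeff (f.natDegree - k) * c ^ (f.natDegree / 2 - (f.natDegree - k))) *
      c ^ (f.natDegree - k) =
      (f.coeff 0)⁻¹ * f.coeff (f.natDegree - k) * c ^ (f.natDegree / 2 - k) := by
    rw [mul_assoc, mul_assoc (f.coeff (f.natDegree - k)), hexp]
    field_simp
  rw [this, mul_left_inj' (hp _)]

/-- If all multiplicities in `ν` are even, twisting the polynomials by `c⁻¹` is a bijection from the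
sequences with `f.rev = f` to those with `f.rev = c • f`. -/
theorem numSeq_eq_of_even (c : Fˣ) {n : ℕ} {ν : n.Partition} (hν : ∀ i, Even (ν.parts.count i)) :
    numSeq c ν = numSeq (1 : Fˣ) ν := by
  let w : Fˣ → MonicSeq F → MonicSeq F := fun c f =>
    ⟨fun i => twist c (f.1 i), fun i => ⟨(monic_natDegree_twist _ (f.2 i).1).1, by
      rw [coeff_twist]
      exact mul_ne_zero (f.2 i).2 (pow_ne_zero _ c.ne_zero)⟩⟩
  have hw : ∀ c f, w c (w c⁻¹ f) = f := fun c f =>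
    Subtype.ext (funext fun i => twist_twist (Units.mul_inv c) (f.2 i).1)
  let e : MonicSeq F ≃ MonicSeq F :=
    { toFun := w c⁻¹
      invFun := w c
      left_inv := hw c
      right_inv := fun f => by
        have := hw c⁻¹ f
        rwa [inv_inv] at this }
  refine (Nat.card_congr (e.subtypeEquiv fun f => ?_)).symm
  have h1 : e f ∈ ofType F ν ↔ f ∈ ofType F ν := forall_congr' fun i => by
    rw [← (monic_natDegree_twist (c⁻¹ : Fˣ).val (f.2 i).1).2]
    rfl
  rw [h1]
  refine and_congr_right fun hf => ?_
  rw [rev_eq_one_smul_iff, rev_eq_smul_iff]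
  refine forall_congr' fun i => ?_
  have h2 := reciprocal_twist_iff (c⁻¹ : Fˣ).ne_zero (f.2 i).1 (f.2 i).2
    (by rw [hf i]; exact hν i)
  rw [← Units.val_inv_eq_inv_val, inv_inv] at h2
  exact h2.symm

/-- If `f i` has odd degree `d`, comparing the constant terms in `f.rev = c • f` shows that
`c ^ d` is the inverse of a square. -/
theorem isSquare_of_odd {c : Fˣ} {n : ℕ} {ν : n.Partition} {i : ℕ} (hi : Odd (ν.parts.count i))
    {f : MonicSeq F} (hf : f ∈ ofType F ν) (hc : f.rev = c • f) : IsSquare c := by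
  have h1 := congrArg (fun g : MonicSeq F => (g.1 i).coeff 0) hc
  change (reciprocal (f.1 i)).coeff 0 = ((f.1 i).scaleRoots c).coeff 0 at h1
  rw [coeff_zero_reciprocal (f.2 i).1, coeff_scaleRoots, hf i, Nat.sub_zero] at h1
  obtain ⟨e, he⟩ := hi
  let u : Fˣ := Units.mk0 _ (f.2 i).2
  have h2 : u⁻¹ = u * c ^ (2 * e + 1) := Units.ext (by
    rw [← he, Units.val_inv_eq_inv_val]
    exact h1)
  refine ⟨u⁻¹ * (c ^ e)⁻¹, ?_⟩
  have h3 : u⁻¹ * u⁻¹ = c * (c ^ e * c ^ e) := by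
    nth_rewrite 2 [h2]
    rw [inv_mul_cancel_left, pow_succ', two_mul, pow_add]
  rw [mul_mul_mul_comm, h3, ← mul_inv, mul_inv_cancel_right]

theorem numSeq_eq_zero {c : Fˣ} (hc : ¬ IsSquare c) {n : ℕ} {ν : n.Partition}
    (hν : ∃ i, Odd (ν.parts.count i)) : numSeq c ν = 0 := by
  obtain ⟨i, hi⟩ := hν
  have : IsEmpty {f : MonicSeq F // f ∈ ofType F ν ∧ f.rev = c • f} :=
    ⟨fun f => hc (isSquare_of_odd hi f.2.1 f.2.2)⟩
  exact Nat.card_of_isEmpty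

theorem pgl_eq_of_numSeq_eq [Finite F] {n : ℕ} {ν : n.Partition}
    (h : ∀ c : Fˣ, numSeq c ν = numSeq (1 : Fˣ) ν) :
    pgl F ν = ∏ i ∈ ν.parts.toFinset, r F (ν.parts.count i) := by
  classical
  have := Fintype.ofFinite Fˣ
  have h1 := pgl_mul_card (F := F) ν
  rw [Finset.sum_congr rfl fun c _ => h c, Finset.sum_const, Finset.card_univ, smul_eq_mul,
    ← Nat.card_eq_fintype_card, mul_comm, numSeq_one] at h1
  exact Nat.eq_of_mul_eq_mul_left Nat.card_pos h1

theorem isSquare_of_even_card [Fintype F] (hq : Even (Fintype.card F)) (c : Fˣ) : IsSquare c := by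
  classical
  have h1 : Nat.Coprime (Nat.card Fˣ) 2 := by
    rw [Nat.card_eq_fintype_card, Fintype.card_units, Nat.coprime_two_right]
    exact Nat.Even.sub_odd Fintype.card_pos hq odd_one
  obtain ⟨a, ha⟩ := (powCoprime h1).surjective c
  exact ⟨a, by rw [← ha, powCoprime_apply, sq]⟩

theorem card_isSquare_mul_two [Fintype F] [Fintype Fˣ] [DecidablePred fun c : Fˣ => IsSquare c]
    (hq : Odd (Fintype.card F)) :
    (Finset.univ.filter fun c : Fˣ => IsSquare c).card * 2 = Nat.card Fˣ := by
  classical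
  have hne : (1 : Fˣ) ≠ -1 := by
    intro h
    have h2 : ringChar F = 2 := by
      by_contra h3
      exact Ring.neg_one_ne_one_of_char_ne_two h3 (congrArg Units.val h).symm
    rw [Nat.odd_iff, FiniteField.even_card_of_char_two h2] at hq
    exact zero_ne_one hq
  have hk : Nat.card (powMonoidHom 2 : Fˣ →* Fˣ).ker = 2 := by
    have : ((powMonoidHom 2 : Fˣ →* Fˣ).ker : Set Fˣ) = {1, -1} := by
      ext a
      rw [SetLike.mem_coe, MonoidHom.mem_ker, powMonoidHom_apply, Units.ext_iff,
        Units.val_pow_eq_pow_val, Units.val_one, sq_eq_one_iff]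
      rw [Set.mem_insert_iff, Set.mem_singleton_iff, Units.ext_iff, Units.ext_iff, Units.val_neg,
        Units.val_one]
    rw [← SetLike.coe_sort_coe, Nat.card_coe_set_eq, this, Set.ncard_pair hne]
  have hr : Nat.card (powMonoidHom 2 : Fˣ →* Fˣ).range =
      (Finset.univ.filter fun c : Fˣ => IsSquare c).card := by
    rw [← SetLike.coe_sort_coe, Nat.card_coe_set_eq, ← Set.ncard_coe_finset]
    congr 1
    ext c
    rw [SetLike.mem_coe, MonoidHom.mem_range, Finset.coe_filter]
    simp only [Finset.mem_univ, true_and, Set.mem_ofPred_eq, isSquare_iff_exists_sq,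
      powMonoidHom_apply]
    exact exists_congr fun a => eq_comm
  have h := (powMonoidHom 2 : Fˣ →* Fˣ).ker.card_mul_index
  rw [Subgroup.index_ker, hk, hr] at h
  rw [mul_comm, h]

theorem two_mul_pgl [Fintype F] (hq : Odd (Fintype.card F)) {n : ℕ} {ν : n.Partition}
    (hν : ∃ i, Odd (ν.parts.count i)) :
    2 * pgl F ν = ∏ i ∈ ν.parts.toFinset, r F (ν.parts.count i) := by
  classical
  have h1 := pgl_mul_card (F := F) ν
  have h2 : ∀ c : Fˣ, numSeq c ν = if IsSquare c then numSeq (1 : Fˣ) ν else 0 := fun c => by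
    split_ifs with h
    · obtain ⟨a, rfl⟩ := isSquare_iff_exists_sq c |>.1 h
      exact numSeq_sq a ν
    · exact numSeq_eq_zero h hν
  rw [Finset.sum_congr rfl fun c _ => h2 c, Finset.sum_ite, Finset.sum_const_zero, add_zero,
    Finset.sum_const, smul_eq_mul, ← card_isSquare_mul_two hq, numSeq_one] at h1
  have h3 : 0 < (Finset.univ.filter fun c : Fˣ => IsSquare c).card :=
    Finset.card_pos.2 ⟨1, by simp⟩
  exact Nat.eq_of_mul_eq_mul_left h3 (by rw [← h1]; ring)

end Evaluation

/-! ### The total number of real classes -/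

/-- Counting the `c` with `R c` according to the unique `i` with `T i c`. -/
theorem card_eq_sum_of_existsUnique {C ι : Type*} [Finite C] [Fintype ι] (R : C → Prop)
    (T : ι → C → Prop) (hT : ∀ c, ∃ i, T i c) (hT' : ∀ i j c, T i c → T j c → i = j) :
    Nat.card {c // R c} = ∑ i, Nat.card {c // R c ∧ T i c} := by
  rw [← Nat.card_sigma]
  refine (Nat.card_congr (Equiv.ofBijective
    (fun x : Σ i, {c // R c ∧ T i c} => (⟨x.2.1, x.2.2.1⟩ : {c // R c})) ⟨?_, ?_⟩)).symm
  · rintro ⟨i, c, hc, hi⟩ ⟨j, c', hc', hj⟩ h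
    obtain rfl : c = c' := congrArg Subtype.val h
    obtain rfl := hT' i j c hi hj
    rfl
  · rintro ⟨c, hc⟩
    obtain ⟨i, hi⟩ := hT c
    exact ⟨⟨i, c, hc, hi⟩, rfl⟩

theorem card_isReal_PGL (F : Type*) [Field F] [Finite F] (n : ℕ) :
    Nat.card {c : ConjClasses (PGL F n) // IsReal c} = ∑ ν : n.Partition, pgl F ν := by
  have : Finite (PGL F n) := Finite.of_surjective _ Matrix.ProjGenLinGroup.mk_surjective
  have : Finite (ConjClasses (PGL F n)) := Finite.of_surjective _ ConjClasses.mk_surjective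
  refine card_eq_sum_of_existsUnique _ _ (fun c => ?_) fun ν ν' c h h' => ?_
  · obtain ⟨x, rfl⟩ := ConjClasses.mk_surjective c
    obtain ⟨g, rfl⟩ := Matrix.ProjGenLinGroup.mk_surjective x
    obtain ⟨ν, hν⟩ := exists_classSeq_mem_ofType g
    exact ⟨ν, g, rfl, hasType_iff.2 hν⟩
  · obtain ⟨g, hg, h⟩ := pglHasType_iff.1 h
    obtain ⟨g', hg', h'⟩ := pglHasType_iff.1 h'
    rw [← hg', ConjClasses.mk_eq_mk_iff_isConj, isConj_PGL_iff] at hg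
    obtain ⟨t, ht⟩ := hg
    rw [← ht, smul_mem_ofType] at h'
    exact ofType_unique h h'

theorem card_isReal_PGU {F K : Type*} [Field F] [Fintype F] [Field K] [Fintype K] [Algebra F K]
    (hK : Fintype.card K = Fintype.card F ^ 2) (n : ℕ) :
    Nat.card {c : ConjClasses (PGU F K n) // IsReal c} = ∑ ν : n.Partition, pgu F K ν := by
  let : StarRing K := frobeniusStarRing hK
  have hs : ∀ a : K, star a = a ^ Fintype.card F := fun _ => rfl
  obtain ⟨l, hl⟩ : ∃ l : K, star l ≠ l := exists_pow_card_ne hK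
  have : Finite (ConjClasses (PGU F K n)) := Finite.of_surjective _ ConjClasses.mk_surjective
  refine card_eq_sum_of_existsUnique _ _ (fun c => ?_) fun ν ν' c h h' => ?_
  · obtain ⟨x, rfl⟩ := ConjClasses.mk_surjective c
    obtain ⟨g, rfl⟩ := QuotientGroup.mk_surjective x
    obtain ⟨ν, hν⟩ := exists_classSeq_mem_ofType g.val
    exact ⟨ν, g, rfl, hasType_iff.2 hν⟩
  · obtain ⟨g, hg, h⟩ := h
    obtain ⟨g', hg', h'⟩ := h'
    rw [hasType_iff] at h h'
    rw [← hg', ConjClasses.mk_eq_mk_iff_isConj, isConj_PGU_iff hs hl] at hg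
    obtain ⟨t, ht⟩ := hg
    rw [← ht] at h'
    exact ofType_unique h ((smul_mem_ofType t.1).1 h')

end RealClasses

theorem lemma3p7 (q : ℕ) {F K : Type*} [Field F] [Fintype F] [Field K] [Fintype K] [Algebra F K]
    (hF : Fintype.card F = q) (hK : Fintype.card K = q ^ 2) (n : ℕ) :
    (∀ ν : n.Partition,
      ((Even q ∨ (Odd q ∧ ∀ i, 1 ≤ i → Even (ν.parts.count i))) →
        RealClasses.pgu F K ν = ∏ i ∈ ν.parts.toFinset, RealClasses.r F (ν.parts.count i)) ∧
      ((Odd q ∧ ∃ i, 1 ≤ i ∧ Odd (ν.parts.count i)) →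
        (RealClasses.pgu F K ν : ℚ) =
          (1 / 2) * ∏ i ∈ ν.parts.toFinset, (RealClasses.r F (ν.parts.count i) : ℚ)) ∧
      RealClasses.pgl F ν = RealClasses.pgu F K ν) ∧
    Nat.card {c : ConjClasses (RealClasses.PGL F n) // RealClasses.IsReal c} =
      Nat.card {c : ConjClasses (RealClasses.PGU F K n) // RealClasses.IsReal c} := by
  subst hF
  refine ⟨fun ν => ⟨fun h => ?_, fun h => ?_, RealClasses.pgl_eq_pgu hK ν⟩, ?_⟩
  · rw [← RealClasses.pgl_eq_pgu hK]
    refine RealClasses.pgl_eq_of_numSeq_eq fun c => ?_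
    rcases h with hq | ⟨-, hν⟩
    · obtain ⟨a, rfl⟩ := (isSquare_iff_exists_sq c).1 (RealClasses.isSquare_of_even_card hq c)
      exact RealClasses.numSeq_sq a ν
    · refine RealClasses.numSeq_eq_of_even c fun i => ?_
      rcases Nat.eq_zero_or_pos i with rfl | hi
      · rw [Multiset.count_eq_zero.2 fun h => (ν.parts_pos h).ne rfl]
        exact Even.zero
      · exact hν i hi
  · obtain ⟨hq, i, -, hi⟩ := h
    rw [← RealClasses.pgl_eq_pgu hK, ← Nat.cast_prod, ← RealClasses.two_mul_pgl hq ⟨i, hi⟩]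
    push_cast
    ring
  · rw [RealClasses.card_isReal_PGL, RealClasses.card_isReal_PGU hK]
    exact Finset.sum_congr rfl fun ν _ => RealClasses.pgl_eq_pgu hK ν
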